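/- Let $n\ge 0$ be an integer with $n\neq 2$, and let $\eta=(\eta^{ij})$ be an invertible symmetric complex $n\times n$ matrix. Let $\mathrm{Cl}(n)$ be the complex Clifford algebra with generators $\gamma^1,\dots,\gamma^n$ and relations $\gamma^i\gamma^j+\gamma^j\gamma^i=2\eta^{ij}$, let $W(2n)$ be the Weyl algebra with generators $x^1,\dots,x^n,\partial_1,\dots,\partial_n$ and relations $[x^i,x^j]=[\partial_i,\partial_j]=0$, $[\partial_i,x^j]=\delta_i^j$, and put $\mathcal A=W(2n)\otimes_{\mathbb C}\mathrm{Cl}(n)$. The algebra $\mathcal A$ acts on the space $V=\mathrm{Cl}(n)\otimes_{\mathbb C}\mathbb C[x^1,\dots,x^n]$ of Clifford-valued polynomials: $x^i$ acts by multiplication, $\partial_i$ by $\partial/\partial x^i$, and $\gamma^i$ by left multiplication. Let $V^+=\{\varphi\in V : \sum_i\gamma^i\partial_i\varphi=0\}$ be the space of polynomial solutions of the Dirac equation. Let $X=\frac{\sqrt{-1}}{\sqrt2}\sum_i\gamma^i\partial_i\in\mathcal A$, let $I=\mathcal AX+\mathcal AX^2=\mathcal AX$, let $N=\{a\in\mathcal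 A : Ia\subseteq I\}$ be the normalizer of $I$, and let $Z_n=N/I$ be the reduction algebra. **Theorem.** 1. $V^+$ is a module over $Z_n\otimes_{\mathbb C}\mathrm{Cl}(n)^{\mathrm{op}}$ (ordinary opposite algebra and ordinary tensor product), with $((a+I)\otimes c)\cdot\varphi=(a\cdot\varphi)\,c$ for $a\in N$, $c\in\mathrm{Cl}(n)$, $\varphi\in V^+$. 2. Regard $\mathrm{Cl}(n)$ as its regular representation, i.e. as a $\mathrm{Cl}(n)\otimes\mathrm{Cl}(n)^{\mathrm{op}}$-module by left and right multiplication, so that its subrepresentations are the two-sided ideals of $\mathrm{Cl}(n)$. Then $W\mapsto\{c\in\mathrm{Cl}(n) : c\otimes 1\in W\}$ is an isomorphism of partially ordered sets from the $Z_n\otimes\mathrm{Cl}(n)^{\mathrm{op}}$-submodules of $V^+$ to the subrepresentations of the regular representation of $\mathrm{Cl}(n)$, and $W$ is irreducible if and only if its image is. In particular, the irreducible subrepresentations of $V^+$ correspond bijectively to those of the regular representation of $\mathrm{Cl}(n)$. 3. If $n$ is even, then $V^+$ is irreducible. If $n$ is odd, then $V^+$ is the direct sum of two irreducible submodules. -/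

import Mathlib

open scoped TensorProduct

noncomputable section

namespace DiracReduction

/-! ### The Clifford algebra -/

/-- The quadratic form `v ↦ ∑ i j, η i j * v i * v j` on `ℂⁿ`. -/
abbrev quadForm {n : ℕ} (η : Matrix (Fin n) (Fin n) ℂ) : QuadraticForm ℂ (Fin n → ℂ) :=
  η.toQuadraticForm'

/-- The Clifford algebra `Cl(n) = Cl(ℂⁿ; η)`. -/
abbrev Cl {n : ℕ} (η : Matrix (Fin n) (Fin n) ℂ) : Type :=
  CliffordAlgebra (quadForm η)

/-- The generators `γ^i` of the Clifford algebra. -/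
def gen {n : ℕ} (η : Matrix (Fin n) (Fin n) ℂ) (i : Fin n) : Cl η :=
  CliffordAlgebra.ι (quadForm η) (Pi.single i 1)

/-- The defining relations `γ^i γ^j + γ^j γ^i = 2 η^{ij}` hold for a symmetric matrix `η`. -/
theorem gen_mul_gen_add_swap {n : ℕ} {η : Matrix (Fin n) (Fin n) ℂ} (hη : η.IsSymm)
    (i j : Fin n) :
    gen η i * gen η j + gen η j * gen η i = algebraMap ℂ (Cl η) (2 * η i j) := by
  have h : η j i = η i j := congrFun (congrFun hη i) j
  rw [gen, gen, CliffordAlgebra.ι_mul_ι_add_swap]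
  congr 1
  simp [QuadraticMap.polar, Matrix.toQuadraticForm', LinearMap.BilinMap.toQuadraticMap_apply,
    Matrix.toLinearMap₂'_apply', Matrix.mulVec_add, dotProduct_add, h]
  ring

/-- The algebra `Cl(n) ⊗ Cl(n)ᵒᵖ`. -/
def ClBimod {n : ℕ} (η : Matrix (Fin n) (Fin n) ℂ) : Type := Cl η ⊗[ℂ] (Cl η)ᵐᵒᵖ

instance {n : ℕ} (η : Matrix (Fin n) (Fin n) ℂ) : Ring (ClBimod η) :=
  inferInstanceAs (Ring (Cl η ⊗[ℂ] (Cl η)ᵐᵒᵖ))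

instance {n : ℕ} (η : Matrix (Fin n) (Fin n) ℂ) : Algebra ℂ (ClBimod η) :=
  inferInstanceAs (Algebra ℂ (Cl η ⊗[ℂ] (Cl η)ᵐᵒᵖ))

/-- The regular representation of `Cl(n)`: `Cl(n) ⊗ Cl(n)ᵒᵖ` acts on `Cl(n)` by left and right
multiplication, `(a ⊗ op b) • c = a * c * b`. -/
instance regularModule {n : ℕ} (η : Matrix (Fin n) (Fin n) ℂ) : Module (ClBimod η) (Cl η) :=
  Module.compHom (Cl η) (AlgHom.mulLeftRight ℂ (Cl η) : Cl η ⊗[ℂ] (Cl η)ᵐᵒᵖ →ₐ[ℂ] _).toRingHom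

/-- The pure tensor `a ⊗ op b` in `Cl(n) ⊗ Cl(n)ᵒᵖ`. -/
def ClBimod.tmul {n : ℕ} {η : Matrix (Fin n) (Fin n) ℂ} (a : Cl η) (b : (Cl η)ᵐᵒᵖ) : ClBimod η :=
  a ⊗ₜ[ℂ] b

theorem ClBimod.tmul_smul {n : ℕ} {η : Matrix (Fin n) (Fin n) ℂ} (a c : Cl η) (b : (Cl η)ᵐᵒᵖ) :
    ClBimod.tmul a b • c = a * c * b.unop :=
  AlgHom.mulLeftRight_apply ℂ (Cl η) a b c

/-! ### The Weyl algebra -/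

/-- The relations of the Weyl algebra, on the free generators `x^i = inl i`, `∂_i = inr i`. -/
inductive WeylRel (n : ℕ) :
    FreeAlgebra ℂ (Fin n ⊕ Fin n) → FreeAlgebra ℂ (Fin n ⊕ Fin n) → Prop
  | x_comm (i j : Fin n) :
      WeylRel n (FreeAlgebra.ι ℂ (Sum.inl i) * FreeAlgebra.ι ℂ (Sum.inl j))
        (FreeAlgebra.ι ℂ (Sum.inl j) * FreeAlgebra.ι ℂ (Sum.inl i))
  | d_comm (i j : Fin n) :
      WeylRel n (FreeAlgebra.ι ℂ (Sum.inr i) * FreeAlgebra.ι ℂ (Sum.inr j))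
        (FreeAlgebra.ι ℂ (Sum.inr j) * FreeAlgebra.ι ℂ (Sum.inr i))
  | d_x (i j : Fin n) :
      WeylRel n (FreeAlgebra.ι ℂ (Sum.inr i) * FreeAlgebra.ι ℂ (Sum.inl j))
        (FreeAlgebra.ι ℂ (Sum.inl j) * FreeAlgebra.ι ℂ (Sum.inr i) + if i = j then 1 else 0)

/-- The Weyl algebra `W(2n)` over `ℂ`. -/
def Weyl (n : ℕ) : Type := RingQuot (WeylRel n)

instance (n : ℕ) : Ring (Weyl n) := inferInstanceAs (Ring (RingQuot (WeylRel n)))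

instance (n : ℕ) : Algebra ℂ (Weyl n) := inferInstanceAs (Algebra ℂ (RingQuot (WeylRel n)))

/-- The quotient map from the free algebra onto the Weyl algebra. -/
def Weyl.mk (n : ℕ) : FreeAlgebra ℂ (Fin n ⊕ Fin n) →ₐ[ℂ] Weyl n :=
  RingQuot.mkAlgHom ℂ (WeylRel n)

/-- The generator `x^i` of the Weyl algebra. -/
def Weyl.x {n : ℕ} (i : Fin n) : Weyl n :=
  Weyl.mk n (FreeAlgebra.ι ℂ (Sum.inl i))

/-- The generator `∂_i` of the Weyl algebra. -/
def Weyl.d {n : ℕ} (i : Fin n) : Weyl n :=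
  Weyl.mk n (FreeAlgebra.ι ℂ (Sum.inr i))

/-- Partial derivatives of polynomials commute. -/
theorem pderiv_comm {n : ℕ} (i j : Fin n) (p : MvPolynomial (Fin n) ℂ) :
    MvPolynomial.pderiv i (MvPolynomial.pderiv j p) =
      MvPolynomial.pderiv j (MvPolynomial.pderiv i p) := by
  ext m
  simp only [MvPolynomial.coeff_pderiv]
  by_cases h : i = j
  · rw [h]
  · rw [add_right_comm]
    simp [Ne.symm h, h, mul_right_comm]

/-- The action of the Weyl algebra on `ℂ[x^1, …, x^n]`: `x^i` acts by multiplication and `∂_i`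
by the partial derivative. -/
def weylAction (n : ℕ) : Weyl n →ₐ[ℂ] Module.End ℂ (MvPolynomial (Fin n) ℂ) :=
  RingQuot.liftAlgHom ℂ (s := WeylRel n)
    ⟨FreeAlgebra.lift ℂ (Sum.elim
        (fun i => LinearMap.mulLeft ℂ (MvPolynomial.X i : MvPolynomial (Fin n) ℂ))
        (fun i => (MvPolynomial.pderiv i).toLinearMap)), by
      intro a b h
      induction h with
      | x_comm i j =>
        refine LinearMap.ext fun p => ?_
        simp [mul_left_comm]
      | d_comm i j =>
        refine LinearMap.ext fun p => ?_
        simpa using pderiv_comm i j p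
      | d_x i j =>
        refine LinearMap.ext fun p => ?_
        by_cases hij : i = j
        · subst hij
          simp [Derivation.leibniz, add_comm]
        · simp [Derivation.leibniz, hij, MvPolynomial.pderiv_X, Ne.symm hij]⟩

theorem weylAction_x {n : ℕ} (i : Fin n) (p : MvPolynomial (Fin n) ℂ) :
    weylAction n (Weyl.x i) p = MvPolynomial.X i * p := by
  have h : weylAction n (Weyl.x i) = _ :=
    RingQuot.liftAlgHom_mkAlgHom_apply ℂ _ _ (FreeAlgebra.ι ℂ (Sum.inl i))
  rw [h]
  simp

theorem weylAction_d {n : ℕ} (i : Fin n) (p : MvPolynomial (Fin n) ℂ) :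
    weylAction n (Weyl.d i) p = MvPolynomial.pderiv i p := by
  have h : weylAction n (Weyl.d i) = _ :=
    RingQuot.liftAlgHom_mkAlgHom_apply ℂ _ _ (FreeAlgebra.ι ℂ (Sum.inr i))
  rw [h]
  simp

/-! ### The Weyl–Clifford algebra and Clifford-valued polynomials -/

variable {n : ℕ} (η : Matrix (Fin n) (Fin n) ℂ)

/-- The Weyl–Clifford algebra `W(2n|n) = W(2n) ⊗ Cl(n)`. -/
abbrev WeylCl : Type := Weyl n ⊗[ℂ] Cl η

/-- The space `V = Cl(n) ⊗ ℂ[x^1, …, x^n]` of Clifford-valued polynomials. -/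
abbrev ClPoly : Type := Cl η ⊗[ℂ] MvPolynomial (Fin n) ℂ

/-- The action of `W(2n|n)` on `V`:
`(w ⊗ c) · (b ⊗ p) = (c * b) ⊗ (w · p)`. -/
def action : WeylCl η →ₐ[ℂ] Module.End ℂ (ClPoly η) :=
  Algebra.TensorProduct.lift
    ((Module.End.lTensorAlgHom ℂ (MvPolynomial (Fin n) ℂ) (Cl η)).comp (weylAction n))
    ((Module.End.rTensorAlgHom ℂ (Cl η) (MvPolynomial (Fin n) ℂ)).comp (Algebra.lmul ℂ (Cl η)))
    (fun w c => by
      change _ * _ = _ * _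
      refine TensorProduct.ext' fun b p => ?_
      rfl)

theorem action_tmul (w : Weyl n) (c b : Cl η) (p : MvPolynomial (Fin n) ℂ) :
    action η (w ⊗ₜ c) (b ⊗ₜ p) = (c * b) ⊗ₜ weylAction n w p := by
  have h : action η (w ⊗ₜ c) = _ := Algebra.TensorProduct.lift_tmul _ _ _ w c
  rw [h]
  rfl

/-- The action of `Cl(n)ᵒᵖ` on `V` by right multiplication: `op c · (b ⊗ p) = (b * c) ⊗ p`. -/
def rightAction : (Cl η)ᵐᵒᵖ →ₐ[ℂ] Module.End ℂ (ClPoly η) :=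
  (Module.End.rTensorAlgHom ℂ (Cl η) (MvPolynomial (Fin n) ℂ)).comp (Algebra.lsmul ℂ ℂ (Cl η))

theorem rightAction_tmul (c b : Cl η) (p : MvPolynomial (Fin n) ℂ) :
    rightAction η (MulOpposite.op c) (b ⊗ₜ p) = (b * c) ⊗ₜ p := by
  rfl

/-- The left and right actions commute. -/
theorem action_rightAction (a : WeylCl η) (c : (Cl η)ᵐᵒᵖ) (φ : ClPoly η) :
    action η a (rightAction η c φ) = rightAction η c (action η a φ) := by
  induction a using TensorProduct.induction_on with
  | zero => simp
  | add a b ha hb => simp [ha, hb]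
  | tmul w d =>
    induction φ using TensorProduct.induction_on with
    | zero => simp
    | add φ ψ h₁ h₂ => simp [h₁, h₂]
    | tmul b p =>
      obtain ⟨c, rfl⟩ := MulOpposite.op_surjective c
      simp [action_tmul, rightAction_tmul, mul_assoc]

/-- The constant polynomials: the embedding `Cl(n) → V`, `c ↦ c ⊗ 1`. -/
def const (c : Cl η) : ClPoly η := c ⊗ₜ (1 : MvPolynomial (Fin n) ℂ)

/-! ### The Dirac operator and its polynomial solutions -/

/-- The Dirac operator `γ^i ∂_i ∈ W(2n|n)`. -/
def dirac : WeylCl η := ∑ i, Weyl.d i ⊗ₜ[ℂ] gen η i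

/-- The space `V⁺ = {φ ∈ V | γ^i ∂_i φ = 0}` of polynomial solutions of the Dirac equation. -/
def solutions : Submodule ℂ (ClPoly η) := LinearMap.ker (action η (dirac η))

/-! ### The reduction algebra -/

/-- The image `X = (√-1 / √2) γ^i ∂_i` of the positive odd root vector of `osp(1|2)`. -/
def oddRoot : WeylCl η := (Complex.I / (Real.sqrt 2 : ℂ)) • dirac η

/-- The left ideal `I` of `W(2n|n)` generated by `g₊ = ℂ X ⊕ ℂ E`, where `E = X ^ 2`. -/
def leftIdeal : Ideal (WeylCl η) := Ideal.span {oddRoot η, oddRoot η ^ 2}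

/-- The normalizer `N = {a | I a ⊆ I}` of the left ideal `I` in `W(2n|n)`. -/
def normalizer : Subalgebra ℂ (WeylCl η) where
  carrier := {a | ∀ b ∈ leftIdeal η, b * a ∈ leftIdeal η}
  mul_mem' {a b} ha hb c hc := by
    rw [← mul_assoc]
    exact hb _ (ha _ hc)
  add_mem' {a b} ha hb c hc := by
    rw [mul_add]
    exact add_mem (ha _ hc) (hb _ hc)
  algebraMap_mem' r c hc := by
    rw [← Algebra.commutes]
    exact Ideal.mul_mem_left _ _ hc

/-- The left ideal `I`, which is contained in `N`, as an ideal of `N`. -/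
def normalizerIdeal : Ideal (normalizer η) := (leftIdeal η).comap (normalizer η).val

theorem leftIdeal_subset_normalizer : (leftIdeal η : Set (WeylCl η)) ⊆ normalizer η :=
  fun _ ha b _ => Ideal.mul_mem_left _ b ha

instance normalizerIdeal_isTwoSided : (normalizerIdeal η).IsTwoSided :=
  ⟨fun b h => b.2 _ h⟩

/-- The reduction algebra `Z_n = N / I`. -/
def ReductionAlgebra : Type := normalizer η ⧸ normalizerIdeal η

instance : Ring (ReductionAlgebra η) :=
  inferInstanceAs (Ring (normalizer η ⧸ normalizerIdeal η))

instance : Algebra ℂ (ReductionAlgebra η) :=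
  inferInstanceAs (Algebra ℂ (normalizer η ⧸ normalizerIdeal η))

/-- The quotient map `N → Z_n`. -/
def toReduction : normalizer η →ₐ[ℂ] ReductionAlgebra η :=
  Ideal.Quotient.mkₐ ℂ (normalizerIdeal η)

theorem oddRoot_mem : oddRoot η ∈ leftIdeal η :=
  Ideal.subset_span (by simp)

/-- Elements of `I` annihilate every solution. -/
theorem action_eq_zero {a : WeylCl η} (ha : a ∈ leftIdeal η) {φ : ClPoly η}
    (hφ : φ ∈ solutions η) : action η a φ = 0 := by
  have hX : action η (oddRoot η) φ = 0 := by
    have h : action η (dirac η) φ = 0 := hφ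
    simp [oddRoot, h]
  induction ha using Submodule.span_induction with
  | mem a h =>
    rcases h with rfl | rfl
    · exact hX
    · rw [pow_two, map_mul, Module.End.mul_apply, hX, map_zero]
  | zero => simp
  | add a b _ _ h₁ h₂ => simp [h₁, h₂]
  | smul c a _ h => rw [smul_eq_mul, map_mul, Module.End.mul_apply, h, map_zero]

/-- The normalizer preserves the space of solutions. -/
theorem action_mem {a : WeylCl η} (ha : a ∈ normalizer η) {φ : ClPoly η}
    (hφ : φ ∈ solutions η) : action η a φ ∈ solutions η := by
  have h := action_eq_zero η (ha _ (oddRoot_mem η)) hφ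
  have h2 : (Complex.I / (Real.sqrt 2 : ℂ)) ≠ 0 := by simp
  rw [oddRoot, smul_mul_assoc, map_smul, LinearMap.smul_apply, map_mul,
    Module.End.mul_apply] at h
  exact (smul_eq_zero.mp h).resolve_left h2

/-- Right multiplication preserves the space of solutions. -/
theorem rightAction_mem (c : (Cl η)ᵐᵒᵖ) {φ : ClPoly η} (hφ : φ ∈ solutions η) :
    rightAction η c φ ∈ solutions η := by
  have h : action η (dirac η) φ = 0 := hφ
  change action η (dirac η) _ = 0
  rw [action_rightAction, h, map_zero]

/-- The space `V⁺`, as a type. -/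
def Solutions : Type := solutions η

instance : AddCommGroup (Solutions η) := inferInstanceAs (AddCommGroup (solutions η))

instance : Module ℂ (Solutions η) := inferInstanceAs (Module ℂ (solutions η))

/-- The inclusion `V⁺ → V`. -/
def incl : Solutions η →ₗ[ℂ] ClPoly η := (solutions η).subtype

theorem incl_injective : Function.Injective (incl η) := Subtype.val_injective

/-- The action of the normalizer on the space of solutions. -/
def normalizerAction : normalizer η →ₐ[ℂ] Module.End ℂ (Solutions η) where
  toFun a := ((action η a).restrict fun _ hφ => action_mem η a.2 hφ :
    Module.End ℂ (solutions η))
  map_one' := by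
    ext1 φ
    apply incl_injective
    exact LinearMap.congr_fun (map_one (action η)) (incl η φ)
  map_mul' a b := by
    ext1 φ
    apply incl_injective
    exact LinearMap.congr_fun (map_mul (action η) (a : WeylCl η) b) (incl η φ)
  map_zero' := by
    ext1 φ
    apply incl_injective
    exact LinearMap.congr_fun (map_zero (action η)) (incl η φ)
  map_add' a b := by
    ext1 φ
    apply incl_injective
    exact LinearMap.congr_fun (map_add (action η) (a : WeylCl η) b) (incl η φ)
  commutes' r := by
    ext1 φ
    apply incl_injective
    exact LinearMap.congr_fun (AlgHom.commutes (action η) r) (incl η φ)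

/-- The action of the reduction algebra `Z_n = N / I` on the space of solutions. -/
def reductionAction : ReductionAlgebra η →ₐ[ℂ] Module.End ℂ (Solutions η) :=
  Ideal.Quotient.liftₐ (normalizerIdeal η) (normalizerAction η) fun a ha => by
    ext1 φ
    apply incl_injective
    exact action_eq_zero η (a := (a : WeylCl η)) ha φ.2

/-- The action of `Cl(n)ᵒᵖ` on the space of solutions by right multiplication. -/
def rightSolutionAction : (Cl η)ᵐᵒᵖ →ₐ[ℂ] Module.End ℂ (Solutions η) where
  toFun c := ((rightAction η c).restrict fun _ hφ => rightAction_mem η c hφ :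
    Module.End ℂ (solutions η))
  map_one' := by
    ext1 φ
    apply incl_injective
    exact LinearMap.congr_fun (map_one (rightAction η)) (incl η φ)
  map_mul' a b := by
    ext1 φ
    apply incl_injective
    exact LinearMap.congr_fun (map_mul (rightAction η) a b) (incl η φ)
  map_zero' := by
    ext1 φ
    apply incl_injective
    exact LinearMap.congr_fun (map_zero (rightAction η)) (incl η φ)
  map_add' a b := by
    ext1 φ
    apply incl_injective
    exact LinearMap.congr_fun (map_add (rightAction η) a b) (incl η φ)
  commutes' r := by
    ext1 φ
    apply incl_injective
    exact LinearMap.congr_fun (AlgHom.commutes (rightAction η) r) (incl η φ)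

/-- The algebra `Z_n ⊗ Cl(n)ᵒᵖ`. -/
def ReductionBimod : Type := ReductionAlgebra η ⊗[ℂ] (Cl η)ᵐᵒᵖ

instance : Ring (ReductionBimod η) :=
  inferInstanceAs (Ring (ReductionAlgebra η ⊗[ℂ] (Cl η)ᵐᵒᵖ))

instance : Algebra ℂ (ReductionBimod η) :=
  inferInstanceAs (Algebra ℂ (ReductionAlgebra η ⊗[ℂ] (Cl η)ᵐᵒᵖ))

variable {η} in
/-- The pure tensor `z ⊗ c` in `Z_n ⊗ Cl(n)ᵒᵖ`. -/
def ReductionBimod.tmul (z : ReductionAlgebra η) (c : (Cl η)ᵐᵒᵖ) : ReductionBimod η :=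
  z ⊗ₜ[ℂ] c

/-- The action of `Z_n ⊗ Cl(n)ᵒᵖ` on the space of solutions. -/
def bimoduleAction : ReductionBimod η →ₐ[ℂ] Module.End ℂ (Solutions η) :=
  Algebra.TensorProduct.lift (A := ReductionAlgebra η) (reductionAction η) (rightSolutionAction η) fun z c => by
    obtain ⟨a, rfl⟩ := Ideal.Quotient.mk_surjective z
    ext1 φ
    apply incl_injective
    exact action_rightAction η (a : WeylCl η) c (incl η φ)

/-- `V⁺` as a module over `Z_n ⊗ Cl(n)ᵒᵖ`. -/
instance solutionsModule : Module (ReductionBimod η) (Solutions η) :=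
  Module.compHom (Solutions η) (bimoduleAction η).toRingHom

theorem tmul_smul (a : normalizer η) (c : (Cl η)ᵐᵒᵖ) (φ : Solutions η) :
    incl η (ReductionBimod.tmul (toReduction η a) c • φ) =
      action η (a : WeylCl η) (rightAction η c (incl η φ)) :=
  rfl

theorem const_mem (c : Cl η) : const η c ∈ solutions η := by
  change action η (dirac η) _ = 0
  simp [dirac, const, action_tmul, weylAction_d]

/-- The constant solutions: the embedding `Cl(n) → V⁺`. -/
def constSol (c : Cl η) : Solutions η := (⟨const η c, const_mem η c⟩ : solutions η)

end DiracReduction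

end

/-!
Write `D = γ^i ∂_i` for the Dirac operator, `E = x^i ∂_i` for the Euler operator, `x̸ = γ_i x^i` for
the vector variable and `V⁺` for the kernel of `D` on Clifford-valued polynomials.

Since the ideal `I` is generated by `D`, an element `a` with `D a ∈ 𝒜 D` lies in the normalizer.
From the relations `D x̸ + x̸ D = 2 E + n`, `D γ^i + γ^i D = 2 ∂^i` and `D x^i = x^i D + γ^i` one
finds that the normalizer contains `∂_i`, `E`, and the operators

* `gRed i = γ^i (2 E + n - 2) - 2 x̸ ∂^i`, which acts on constants as `(n - 2) γ^i`;
* `xRed i = x^i (2 E + n) - x̸ γ^i - x̸² ∂^i`, for which `∑ i, xRed i * ∂_i` acts on `V⁺` as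
  `E (2 E + n - 2)` (`sum_xRed_mul_dd`).

Let `W` be a submodule of `V⁺` and `J = {c | c ⊗ 1 ∈ W}`. As `n ≠ 2`, the operators `gRed i` make `J`
a two-sided ideal. Taking derivatives and separating degrees with `E` shows that the coefficients of
every element of `W` lie in `J` (`clCoeff_mem_constIdeal`). Conversely a solution with coefficients
in `J` lies in `W`, by induction on the degree: its derivatives do, and `∑ i, xRed i * ∂_i` recovers
it from them (`mem_polySubspace_of_clCoeff_mem`). So `W ↦ J` is a bijection onto the two-sided
ideals, with inverse `J ↦ {φ ∈ V⁺ | all coefficients of φ lie in J}`.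

The ideals of the Clifford algebra are found from an orthonormal basis, whose vectors are
anticommuting involutions. Conjugation by them acts on words in the basis by signs, and a word fixed
by all of these conjugations is, up to sign, `1` or, for odd `n`, the volume element. Therefore a
nonzero ideal contains a nonzero combination of these central elements (`exists_central_mem`). For
even `n` the algebra is thus simple; for odd `n` it is the sum of the two minimal ideals cut out by
the idempotents `(1 ± u) / 2`, where `u` is a multiple of the volume element with `u² = 1`.
-/

noncomputable section

namespace DiracReduction

/-! ### Two-sided ideals in an algebra generated by anticommuting involutions -/

section Words

variable {A : Type*} [Ring A] [Algebra ℂ A] {n : ℕ} {e : Fin n → A}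

theorem mul_word_eq_smul (hanti : ∀ i j, i ≠ j → e i * e j = -(e j * e i))
    (i : Fin n) (w : List (Fin n)) :
    e i * (w.map e).prod = (-1 : ℂ) ^ (w.length + w.count i) • ((w.map e).prod * e i) := by
  induction w with
  | nil => simp
  | cons j w ih =>
    by_cases hij : i = j
    · subst hij
      simp only [List.map_cons, List.prod_cons, List.length_cons, List.count_cons_self]
      conv_lhs => rw [ih, mul_smul_comm, ← mul_assoc]
      congr 1
      ring
    · have hji : (j == i) = false := by simpa using Ne.symm hij
      simp only [List.map_cons, List.prod_cons, List.length_cons, List.count_cons, hji]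
      rw [← mul_assoc, hanti i j hij, neg_mul, mul_assoc, ih, mul_smul_comm, ← mul_assoc,
        ← neg_smul]
      congr 1
      simp
      ring

theorem conj_word_eq_smul (hsq : ∀ i, e i * e i = 1)
    (hanti : ∀ i j, i ≠ j → e i * e j = -(e j * e i)) (i : Fin n) (w : List (Fin n)) :
    e i * (w.map e).prod * e i = (-1 : ℂ) ^ (w.length + w.count i) • (w.map e).prod := by
  rw [mul_word_eq_smul hanti, smul_mul_assoc, mul_assoc, hsq, mul_one]

theorem word_reverse_mul_word {B : Type*} [Ring B] {e : Fin n → B} (hsq : ∀ i, e i * e i = 1)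
    (w : List (Fin n)) :
    (w.reverse.map e).prod * (w.map e).prod = 1 := by
  induction w with
  | nil => simp
  | cons i w ih =>
    simp only [List.reverse_cons, List.map_append, List.map_cons, List.map_nil, List.prod_append,
      List.prod_cons, List.prod_nil, mul_one]
    rw [mul_assoc, ← mul_assoc (e i), hsq, one_mul, ih]

/-- A word in which every letter occurs an even number of times is a sign: the two occurrences of
its first letter can be brought together, at the cost of a sign, and cancelled. -/
theorem word_eq_one_or_neg_one (hsq : ∀ i, e i * e i = 1)
    (hanti : ∀ i j, i ≠ j → e i * e j = -(e j * e i)) (w : List (Fin n))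
    (hw : ∀ i, Even (w.count i)) : (w.map e).prod = 1 ∨ (w.map e).prod = -1 := by
  induction hN : w.length using Nat.strong_induction_on generalizing w with
  | _ N ih =>
    match w, hw, hN with
    | [], _, _ => simp
    | i :: w, hw, hN =>
      have hi : i ∈ w := by
        by_contra h
        have := hw i
        rw [List.count_cons_self, List.count_eq_zero_of_not_mem h] at this
        simp at this
      obtain ⟨u, v, rfl⟩ := List.append_of_mem hi
      have key := ih (u ++ v).length (by simp at hN ⊢; lia) (u ++ v) (fun j => by
        have := hw j
        simp only [List.count_cons, List.count_append] at this ⊢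
        by_cases h : i = j <;> simp [h] at this ⊢ <;> grind) rfl
      have h : ((i :: (u ++ i :: v)).map e).prod =
          (-1 : ℂ) ^ (u.length + u.count i) • ((u ++ v).map e).prod := by
        simp only [List.map_cons, List.map_append, List.prod_cons, List.prod_append]
        rw [← mul_assoc, mul_word_eq_smul hanti, smul_mul_assoc, mul_assoc, ← mul_assoc (e i), hsq,
          one_mul]
      rw [h]
      rcases neg_one_pow_eq_or ℂ (u.length + u.count i) with hs | hs <;> rw [hs] <;>
        rcases key with hk | hk <;> rw [hk] <;> simp

theorem length_eq_sum_count (w : List (Fin n)) : w.length = ∑ i, w.count i := by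
  simpa using (Multiset.sum_count_eq_card (s := Finset.univ) (m := (w : Multiset (Fin n)))
    (fun _ _ => Finset.mem_univ _)).symm

/-- A word that commutes with all generators is, up to a sign, `1` or the volume element
`e₁ ⋯ eₙ`, the latter only in odd dimension. -/
theorem central_word_cases (hsq : ∀ i, e i * e i = 1)
    (hanti : ∀ i j, i ≠ j → e i * e j = -(e j * e i)) (w : List (Fin n))
    (hw : ∀ i, Even (w.length + w.count i)) :
    ((w.map e).prod = 1 ∨ (w.map e).prod = -1) ∨
      (Odd n ∧ ((w.map e).prod = ((List.finRange n).map e).prod ∨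
        (w.map e).prod = -((List.finRange n).map e).prod)) := by
  rcases Nat.even_or_odd w.length with h | h
  · exact Or.inl (word_eq_one_or_neg_one hsq hanti w fun i => by have := hw i; grind)
  · -- every letter occurs an odd number of times, so the reversed volume element cancels the word
    right
    have hodd : ∀ i, Odd (w.count i) := fun i => by have := hw i; grind
    refine ⟨?_, ?_⟩
    · rw [length_eq_sum_count, Finset.odd_sum_iff_odd_card_odd] at h
      simpa [hodd] using h
    · have h1 := word_eq_one_or_neg_one hsq hanti ((List.finRange n).reverse ++ w) (fun i => by
        have := hodd i
        rw [List.count_append, List.count_reverse,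
          List.count_eq_one_of_mem (List.nodup_finRange n) (List.mem_finRange i)]
        grind)
      have h2 := word_reverse_mul_word hsq (List.finRange n).reverse
      rw [List.reverse_reverse] at h2
      have h3 : (w.map e).prod = ((List.finRange n).map e).prod *
          (((List.finRange n).reverse ++ w).map e).prod := by
        rw [List.map_append, List.prod_append, ← mul_assoc, h2, one_mul]
      rcases h1 with h1 | h1 <;> rw [h1] at h3 <;> simp [h3]

theorem exists_sum_words (hgen : Algebra.adjoin ℂ (Set.range e) = ⊤) (a : A) :
    ∃ (s : Finset (List (Fin n))) (f : List (Fin n) → ℂ), a = ∑ w ∈ s, f w • (w.map e).prod := by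
  have ha : a ∈ Submodule.span ℂ (Set.range fun w : List (Fin n) => (w.map e).prod) := by
    have h : a ∈ Subalgebra.toSubmodule (Algebra.adjoin ℂ (Set.range e)) := by simp [hgen]
    rw [Algebra.adjoin_eq_span] at h
    refine Submodule.span_mono ?_ h
    intro x hx
    obtain ⟨l, hl, rfl⟩ := Submonoid.exists_list_of_mem_closure hx
    clear hx h
    induction l with
    | nil => exact ⟨[], rfl⟩
    | cons y l ih =>
      obtain ⟨i, rfl⟩ := hl y (by simp)
      obtain ⟨w, hw⟩ := ih fun z hz => hl z (by simp [hz])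
      exact ⟨i :: w, by simpa using congrArg (e i * ·) hw⟩
  obtain ⟨c, hc⟩ := (Finsupp.mem_span_range_iff_exists_finsupp).1 ha
  exact ⟨c.support, c, hc.symm⟩

/-- A nonzero two-sided ideal contains a nonzero central element, in the span of `1` and (in odd
dimension) the volume element. An element of the ideal that is a sum of as few words as possible
may be multiplied by the inverse of one of them, so that `1` is among its words; adding or
subtracting its conjugate by a generator then shortens it, unless all its words are central. -/
theorem exists_central_mem (hsq : ∀ i, e i * e i = 1)
    (hanti : ∀ i j, i ≠ j → e i * e j = -(e j * e i))
    (hgen : Algebra.adjoin ℂ (Set.range e) = ⊤) (J : Submodule ℂ A)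
    (hJ : ∀ a x b, x ∈ J → a * x * b ∈ J) (hne : J ≠ ⊥) :
    ∃ z ∈ J, z ≠ 0 ∧ ∃ c d : ℂ, z = c • 1 + d • ((List.finRange n).map e).prod ∧
      (d = 0 ∨ Odd n) := by
  have main : ∀ (N : ℕ) (ι : Finset (List (Fin n))) (f : List (Fin n) → ℂ)
      (g : List (Fin n) → List (Fin n)), ι.card = N →
      ∑ w ∈ ι, f w • ((g w).map e).prod ∈ J → ∑ w ∈ ι, f w • ((g w).map e).prod ≠ 0 →
      ∃ z ∈ J, z ≠ 0 ∧ ∃ c d : ℂ, z = c • 1 + d • ((List.finRange n).map e).prod ∧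
      (d = 0 ∨ Odd n) := by
    intro N
    induction N using Nat.strong_induction_on with
    | _ N ih =>
    intro ι f g hcard hmem hnz
    obtain ⟨w₀, hw₀, -⟩ := Finset.exists_ne_zero_of_sum_ne_zero hnz
    -- translate so that the word at `w₀` becomes central
    set h : List (Fin n) → List (Fin n) := fun w => (g w₀).reverse ++ g w with hh
    set a : A := ∑ w ∈ ι, f w • ((h w).map e).prod with ha
    have haeq : a = ((g w₀).reverse.map e).prod * ∑ w ∈ ι, f w • ((g w).map e).prod := by
      rw [ha, Finset.mul_sum]
      refine Finset.sum_congr rfl fun w _ => ?_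
      rw [hh, List.map_append, List.prod_append, mul_smul_comm]
    have haJ : a ∈ J := by
      rw [haeq]
      simpa using hJ ((g w₀).reverse.map e).prod _ 1 hmem
    have ha0 : a ≠ 0 := by
      intro h0
      have h2 := word_reverse_mul_word hsq (g w₀).reverse
      rw [List.reverse_reverse] at h2
      apply hnz
      rw [← one_mul (∑ w ∈ ι, f w • ((g w).map e).prod), ← h2, mul_assoc, ← haeq, h0, mul_zero]
    have hw₀even : ∀ i, Even ((h w₀).length + (h w₀).count i) := by
      intro i
      simp only [hh, List.length_append, List.length_reverse, List.count_append,
        List.count_reverse]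
      exact ⟨(g w₀).length + (g w₀).count i, by ring⟩
    by_cases hall : ∀ w ∈ ι, ∀ i, Even ((h w).length + (h w).count i)
    · refine ⟨a, haJ, ha0, ?_⟩
      rw [ha]
      have hS : ∀ w ∈ ι, ∃ c d : ℂ, f w • ((h w).map e).prod =
          c • 1 + d • ((List.finRange n).map e).prod ∧ (d = 0 ∨ Odd n) := by
        intro w hw
        rcases central_word_cases hsq hanti (h w) (hall w hw) with (h1 | h1) | ⟨ho, h1 | h1⟩
        · exact ⟨f w, 0, by simp [h1], by simp⟩
        · exact ⟨-f w, 0, by simp [h1], by simp⟩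
        · exact ⟨0, f w, by simp [h1], by simp [ho]⟩
        · exact ⟨0, -f w, by simp [h1], by simp [ho]⟩
      clear_value h a
      clear ha haeq hmem hnz hcard ih hall hw₀ haJ ha0
      induction ι using Finset.induction_on with
      | empty => exact ⟨0, 0, by simp⟩
      | insert w s hws ihs =>
        obtain ⟨c, d, h1, h2⟩ := hS w (by simp)
        obtain ⟨c', d', h3, h4⟩ := ihs fun v hv => hS v (by simp [hv])
        refine ⟨c + c', d + d', ?_, ?_⟩
        · rw [Finset.sum_insert hws, h1, h3]
          module
        · rcases h2 with h2 | h2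
          · rcases h4 with h4 | h4
            · simp [h2, h4]
            · exact Or.inr h4
          · exact Or.inr h2
    · push Not at hall
      obtain ⟨w₁, hw₁, i, hi⟩ := hall
      have hconj : e i * a * e i =
          ∑ w ∈ ι, ((-1) ^ ((h w).length + (h w).count i) * f w) • ((h w).map e).prod := by
        rw [ha, Finset.mul_sum, Finset.sum_mul]
        refine Finset.sum_congr rfl fun w _ => ?_
        rw [mul_smul_comm, smul_mul_assoc, conj_word_eq_smul hsq hanti, smul_smul, mul_comm]
      have hconjJ : e i * a * e i ∈ J := hJ _ _ _ haJ
      -- for either sign `s`, the words with conjugation sign `-s` cancel in `a + s e a e`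
      have shorten : ∀ (s : ℂ) (w₂ : List (Fin n)), w₂ ∈ ι →
          1 + s * (-1) ^ ((h w₂).length + (h w₂).count i) = 0 → a + s • (e i * a * e i) ≠ 0 →
          ∃ z ∈ J, z ≠ 0 ∧ ∃ c d : ℂ, z = c • 1 + d • ((List.finRange n).map e).prod ∧
            (d = 0 ∨ Odd n) := by
        intro s w₂ hw₂ hs hne0
        have heq : a + s • (e i * a * e i) = ∑ w ∈ ι.erase w₂,
            ((1 + s * (-1) ^ ((h w).length + (h w).count i)) * f w) • ((h w).map e).prod := by
          rw [Finset.sum_erase _ (by rw [hs]; simp), hconj, ha, Finset.smul_sum,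
            ← Finset.sum_add_distrib]
          refine Finset.sum_congr rfl fun w _ => ?_
          module
        refine ih (ι.erase w₂).card (by rw [← hcard]; exact Finset.card_erase_lt_of_mem hw₂)
          (ι.erase w₂) _ h rfl (heq ▸ ?_) (heq ▸ hne0)
        exact J.add_mem haJ (J.smul_mem _ hconjJ)
      by_cases hb : a + (-1 : ℂ) • (e i * a * e i) = 0
      · refine shorten 1 w₁ hw₁ ?_ ?_
        · rw [(Nat.not_even_iff_odd.1 hi).neg_one_pow]
          norm_num
        · have h2 : e i * a * e i = a := by
            rw [neg_one_smul] at hb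
            exact (add_neg_eq_zero.1 hb).symm
          rw [h2, one_smul, ← two_smul ℂ]
          exact smul_ne_zero two_ne_zero ha0
      · refine shorten (-1) w₀ hw₀ ?_ hb
        rw [(hw₀even i).neg_one_pow]
        norm_num
  obtain ⟨a, haJ, ha0⟩ := (Submodule.ne_bot_iff J).1 hne
  obtain ⟨s, f, rfl⟩ := exists_sum_words hgen a
  exact main _ s f id rfl haJ ha0

/-- In odd dimension a suitable multiple `u` of the volume element is a central involution. -/
theorem exists_central_involution (hsq : ∀ i, e i * e i = 1)
    (hanti : ∀ i j, i ≠ j → e i * e j = -(e j * e i))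
    (hgen : Algebra.adjoin ℂ (Set.range e) = ⊤) (hn : Odd n) :
    ∃ s : ℂ, s ≠ 0 ∧ (s • ((List.finRange n).map e).prod) * (s • ((List.finRange n).map e).prod) = 1
      ∧ ∀ a, a * (s • ((List.finRange n).map e).prod) = (s • ((List.finRange n).map e).prod) * a := by
  set ω := ((List.finRange n).map e).prod with hω
  have hcomm : ∀ a, a * ω = ω * a := by
    intro a
    have ha : a ∈ Algebra.adjoin ℂ (Set.range e) := by simp [hgen]
    induction ha using Algebra.adjoin_induction with
    | mem x hx =>
      obtain ⟨i, rfl⟩ := hx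
      have h := mul_word_eq_smul hanti i (List.finRange n)
      rw [List.count_eq_one_of_mem (List.nodup_finRange n) (List.mem_finRange i),
        List.length_finRange, hn.add_one.neg_one_pow, one_smul] at h
      exact h
    | algebraMap r => exact Algebra.commutes r ω
    | add x y _ _ hx hy => rw [add_mul, mul_add, hx, hy]
    | mul x y _ _ hx hy => rw [mul_assoc, hy, ← mul_assoc, hx, mul_assoc]
  have hω2 : ω * ω = 1 ∨ ω * ω = -1 := by
    have h := word_eq_one_or_neg_one hsq hanti (List.finRange n ++ List.finRange n) (fun i => by
      rw [List.count_append]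
      exact ⟨_, rfl⟩)
    rwa [List.map_append, List.prod_append] at h
  rcases hω2 with h | h
  · exact ⟨1, one_ne_zero, by simpa using h, by simpa using hcomm⟩
  · refine ⟨Complex.I, Complex.I_ne_zero, ?_, fun a => ?_⟩
    · rw [smul_mul_smul_comm, h, Complex.I_mul_I]
      simp
    · rw [mul_smul_comm, smul_mul_assoc, hcomm]

theorem one_mem_of_even (hsq : ∀ i, e i * e i = 1)
    (hanti : ∀ i j, i ≠ j → e i * e j = -(e j * e i))
    (hgen : Algebra.adjoin ℂ (Set.range e) = ⊤) (hn : Even n) (J : Submodule ℂ A)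
    (hJ : ∀ a x b, x ∈ J → a * x * b ∈ J) (hne : J ≠ ⊥) : (1 : A) ∈ J := by
  obtain ⟨z, hzJ, hz0, c, d, rfl, hd⟩ := exists_central_mem hsq hanti hgen J hJ hne
  have hd0 : d = 0 := hd.resolve_right (Nat.not_odd_iff_even.2 hn)
  subst hd0
  simp only [zero_smul, add_zero] at hzJ hz0
  have hc : c ≠ 0 := by
    rintro rfl
    simp at hz0
  simpa [smul_smul, hc] using J.smul_mem c⁻¹ hzJ

/-- The ideal cut out by the idempotent `(1 + u) / 2` is minimal, for `u` a central involution
proportional to the volume element. -/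
theorem one_add_mem_of_le (hsq : ∀ i, e i * e i = 1)
    (hanti : ∀ i j, i ≠ j → e i * e j = -(e j * e i))
    (hgen : Algebra.adjoin ℂ (Set.range e) = ⊤) {u : A} (hu : u * u = 1)
    {s : ℂ} (hs : s • u = ((List.finRange n).map e).prod) (J : Submodule ℂ A)
    (hJ : ∀ a x b, x ∈ J → a * x * b ∈ J) (hle : ∀ x ∈ J, x * u = x) (hne : J ≠ ⊥) :
    1 + u ∈ J := by
  obtain ⟨z, hzJ, hz0, c, d, rfl, -⟩ := exists_central_mem hsq hanti hgen J hJ hne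
  rw [← hs, smul_smul] at hzJ hz0
  have h := hle _ hzJ
  have h2 : (2 : ℂ) • (c • 1 + (d * s) • u) = (c + d * s) • (1 + u) := by
    rw [two_smul]
    nth_rewrite 1 [← h]
    rw [add_mul, smul_mul_assoc, one_mul, smul_mul_assoc, hu]
    module
  have hc : c + d * s ≠ 0 := by
    intro h0
    rw [h0, zero_smul] at h2
    exact hz0 ((smul_eq_zero.1 h2).resolve_left two_ne_zero)
  have h3 := J.smul_mem (c + d * s)⁻¹ (J.smul_mem (2 : ℂ) hzJ)
  rwa [h2, smul_smul, inv_mul_cancel₀ hc, one_smul] at h3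

end Words

/-! ### Two-sided ideals of the Clifford algebra -/

variable {n : ℕ} {η : Matrix (Fin n) (Fin n) ℂ}

theorem associated_quadForm_separatingLeft (hsymm : η.IsSymm) (hdet : IsUnit η.det) :
    (QuadraticMap.associated (R := ℂ) (quadForm η)).SeparatingLeft := by
  have h : QuadraticMap.associated (R := ℂ) (quadForm η) = Matrix.toLinearMap₂' ℂ η := by
    ext i j
    have hij : η j i = η i j := congrFun (congrFun hsymm i) j
    simp [QuadraticMap.associated_apply, Matrix.toQuadraticForm',
      LinearMap.BilinMap.toQuadraticMap_apply, Matrix.toLinearMap₂'_apply',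
      Matrix.mulVec_add, hij]
    ring
  rw [h]
  exact ((Matrix.separatingLeft_iff_det_ne_zero).2 hdet.ne_zero).toLinearMap₂'

/-- Over `ℂ` a nondegenerate form has an orthonormal basis, so the Clifford algebra is generated by
`n` anticommuting odd involutions. -/
theorem exists_orthonormal_generators (hsymm : η.IsSymm) (hdet : IsUnit η.det) :
    ∃ e : Fin n → Cl η, (∀ i, e i * e i = 1) ∧ (∀ i j, i ≠ j → e i * e j = -(e j * e i)) ∧
      Algebra.adjoin ℂ (Set.range e) = ⊤ ∧ ∀ i, CliffordAlgebra.involute (e i) = -e i := by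
  obtain ⟨f⟩ := QuadraticForm.equivalent_weightedSumSquares_of_isAlgClosed (quadForm η)
    (associated_quadForm_separatingLeft hsymm hdet)
  have hfin : Module.finrank ℂ (Fin n → ℂ) = n := by simp
  rw [hfin] at f
  have hf : ∀ v, quadForm η (f.symm v) = ∑ i, v i * v i := by
    intro v
    rw [f.symm.map_app]
    simp [QuadraticMap.weightedSumSquares_apply]
  refine ⟨fun i => CliffordAlgebra.ι (quadForm η) (f.symm (Pi.single i 1)), ?_, ?_, ?_, ?_⟩
  · intro i
    rw [CliffordAlgebra.ι_sq_scalar, hf]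
    simp [Pi.single_apply]
  · intro i j hij
    rw [eq_neg_iff_add_eq_zero, CliffordAlgebra.ι_mul_ι_add_swap, QuadraticMap.polar, ← map_add,
      hf, hf, hf, ← Finset.sum_sub_distrib, ← Finset.sum_sub_distrib, Finset.sum_eq_zero, map_zero]
    intro k _
    by_cases hi : k = i
    · subst hi
      simp [hij]
    · simp [hi]
  · rw [eq_top_iff, ← CliffordAlgebra.adjoin_range_ι]
    refine Algebra.adjoin_le ?_
    rintro _ ⟨v, rfl⟩
    have hv : v = ∑ i, f v i • f.symm (Pi.single i 1) := by
      have : f.symm.toLinearEquiv (f v) = v := f.toLinearEquiv.symm_apply_apply v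
      conv_lhs => rw [← this, pi_eq_sum_univ' (f v), map_sum]
      refine Finset.sum_congr rfl fun i _ => ?_
      rw [map_smul]
      rfl
    rw [hv, map_sum]
    refine Subalgebra.sum_mem _ fun i _ => ?_
    rw [map_smul]
    exact Subalgebra.smul_mem _ (Algebra.subset_adjoin (Set.mem_range_self i)) _
  · intro i
    exact CliffordAlgebra.involute_ι _

theorem mul_mem_of_regular (J : Submodule (ClBimod η) (Cl η)) (a x b : Cl η) (hx : x ∈ J) :
    a * x * b ∈ J := by
  simpa [ClBimod.tmul_smul] using J.smul_mem (ClBimod.tmul a (MulOpposite.op b)) hx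

/-- A linear subspace stable under left and right multiplication, as a subrepresentation of the
regular representation. -/
def regularSubmodule (J : Submodule ℂ (Cl η)) (hJ : ∀ a x b, x ∈ J → a * x * b ∈ J) :
    Submodule (ClBimod η) (Cl η) where
  __ := J.toAddSubmonoid
  smul_mem' z x hx := by
    change x ∈ J at hx
    revert z
    have h : ∀ z : Cl η ⊗[ℂ] (Cl η)ᵐᵒᵖ, AlgHom.mulLeftRight ℂ (Cl η) z x ∈ J := by
      intro z
      induction z using TensorProduct.induction_on with
      | zero => simp
      | tmul a b =>
        rw [AlgHom.mulLeftRight_apply]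
        exact hJ a x b.unop hx
      | add y z hy hz =>
        rw [map_add, LinearMap.add_apply]
        exact J.add_mem hy hz
    exact h

/-- A subrepresentation of the regular representation, as a linear subspace. -/
def regularSubspace (J : Submodule (ClBimod η) (Cl η)) : Submodule ℂ (Cl η) where
  __ := J.toAddSubmonoid
  smul_mem' c x hx := by
    have := mul_mem_of_regular J (algebraMap ℂ _ c) x 1 hx
    rwa [mul_one, ← Algebra.smul_def] at this

theorem mem_regularSubspace {J : Submodule (ClBimod η) (Cl η)} {x : Cl η} :
    x ∈ regularSubspace J ↔ x ∈ J := Iff.rfl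

theorem regularSubspace_ne_bot {J : Submodule (ClBimod η) (Cl η)} (h : J ≠ ⊥) :
    regularSubspace J ≠ ⊥ := by
  obtain ⟨x, hx, h0⟩ := (Submodule.ne_bot_iff J).1 h
  exact (Submodule.ne_bot_iff _).2 ⟨x, hx, h0⟩

theorem regular_isSimple_of_even (hsymm : η.IsSymm) (hdet : IsUnit η.det) (hn : Even n) :
    IsSimpleModule (ClBimod η) (Cl η) := by
  obtain ⟨e, hsq, hanti, hgen, -⟩ := exists_orthonormal_generators hsymm hdet
  rw [isSimpleModule_iff]
  refine { eq_bot_or_eq_top := fun J => ?_ }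
  by_cases h : J = ⊥
  · exact Or.inl h
  · have h1 : (1 : Cl η) ∈ J := one_mem_of_even hsq hanti hgen hn (regularSubspace J)
      (fun a x b => mul_mem_of_regular J a x b) (regularSubspace_ne_bot h)
    exact Or.inr ((Submodule.eq_top_iff').2 fun x => by
      simpa using mul_mem_of_regular J x 1 1 h1)

/-- The two-sided ideal `{x | x u = x}` for a central element `u`. -/
def fixedIdeal (u : Cl η) (hu : ∀ a, a * u = u * a) : Submodule (ClBimod η) (Cl η) :=
  regularSubmodule (LinearMap.ker (LinearMap.mulRight ℂ u - LinearMap.id)) (fun a x b hx => by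
    have hx' : x * u = x := by simpa [sub_eq_zero] using hx
    simp [sub_eq_zero, mul_assoc, hu b]
    rw [← mul_assoc x, hx'])

theorem mem_fixedIdeal {u : Cl η} {hu : ∀ a, a * u = u * a} {x : Cl η} :
    x ∈ fixedIdeal u hu ↔ x * u = x := by
  change x ∈ LinearMap.ker (LinearMap.mulRight ℂ u - LinearMap.id) ↔ _
  simp [sub_eq_zero]

theorem fixedIdeal_isAtom {e : Fin n → Cl η} (hsq : ∀ i, e i * e i = 1)
    (hanti : ∀ i j, i ≠ j → e i * e j = -(e j * e i))
    (hgen : Algebra.adjoin ℂ (Set.range e) = ⊤) {u : Cl η} (hu : ∀ a, a * u = u * a)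
    (huu : u * u = 1) {s : ℂ} (hs : s • u = ((List.finRange n).map e).prod)
    (hu1 : 1 + u ≠ 0) : IsAtom (fixedIdeal u hu) := by
  have hmem : 1 + u ∈ fixedIdeal u hu := by
    rw [mem_fixedIdeal, add_mul, huu, one_mul, add_comm]
  refine ⟨(Submodule.ne_bot_iff _).2 ⟨_, hmem, hu1⟩, fun J hJ => ?_⟩
  by_contra h
  refine hJ.not_ge fun x hx => ?_
  have h1 : 1 + u ∈ J := one_add_mem_of_le hsq hanti hgen huu hs (regularSubspace J)
      (fun a x b => mul_mem_of_regular J a x b) (fun x hx => mem_fixedIdeal.1 (hJ.le hx))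
      (regularSubspace_ne_bot h)
  have h2 := (regularSubspace J).smul_mem (2⁻¹ : ℂ) (mul_mem_of_regular J x (1 + u) 1 h1)
  rwa [mul_one, mul_add, mul_one, mem_fixedIdeal.1 hx, ← two_smul ℂ, smul_smul,
    inv_mul_cancel₀ two_ne_zero, one_smul] at h2

theorem exists_isAtom_isCompl_of_odd (hsymm : η.IsSymm) (hdet : IsUnit η.det) (hn : Odd n) :
    ∃ J₁ J₂ : Submodule (ClBimod η) (Cl η), IsAtom J₁ ∧ IsAtom J₂ ∧ IsCompl J₁ J₂ := by
  obtain ⟨e, hsq, hanti, hgen, hinv⟩ := exists_orthonormal_generators hsymm hdet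
  obtain ⟨s, hs0, huu, hu⟩ := exists_central_involution hsq hanti hgen hn
  -- the volume element is odd, hence not a scalar
  have hodd : CliffordAlgebra.involute (((List.finRange n).map e).prod) =
      -((List.finRange n).map e).prod := by
    have key : ∀ w : List (Fin n), CliffordAlgebra.involute ((w.map e).prod) =
        (-1 : ℂ) ^ w.length • (w.map e).prod := by
      intro w
      induction w with
      | nil => simp
      | cons i w ih =>
        rw [List.map_cons, List.prod_cons, map_mul, ih, hinv, List.length_cons, pow_succ,
          mul_smul_comm, neg_mul]
        module
    rw [key, List.length_finRange, hn.neg_one_pow, neg_one_smul]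
  set u : Cl η := s • ((List.finRange n).map e).prod with hudef
  have hodd' : CliffordAlgebra.involute u = -u := by
    rw [hudef, map_smul, hodd, smul_neg]
  have h1 : ∀ c : ℂ, c ≠ 0 → 1 + c • u ≠ 0 := by
    intro c _ h
    have h' := congrArg CliffordAlgebra.involute h
    rw [map_add, map_one, map_smul, hodd', map_zero] at h'
    have h2 : (2 : ℂ) • (1 : Cl η) = 0 := by
      rw [two_smul]
      calc (1 : Cl η) + 1 = (1 + c • u) + (1 + c • -u) := by module
        _ = 0 := by rw [h, h', add_zero]
    have : Invertible (2 : ℂ) := invertibleOfNonzero two_ne_zero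
    exact one_ne_zero ((smul_eq_zero.1 h2).resolve_left two_ne_zero)
  have hu' : ∀ a, a * -u = -u * a := fun a => by rw [mul_neg, neg_mul, hu]
  refine ⟨fixedIdeal u hu, fixedIdeal (-u) hu', ?_, ?_, ?_⟩
  · exact fixedIdeal_isAtom hsq hanti hgen hu huu (s := s⁻¹)
      (by rw [hudef, smul_smul, inv_mul_cancel₀ hs0, one_smul])
      (by simpa using h1 1 one_ne_zero)
  · exact fixedIdeal_isAtom hsq hanti hgen hu' (by rw [neg_mul_neg, huu]) (s := -s⁻¹)
      (by rw [hudef, smul_neg, neg_smul, neg_neg, smul_smul, inv_mul_cancel₀ hs0, one_smul])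
      (by simpa using h1 (-1) (by simp))
  · constructor
    · rw [Submodule.disjoint_def]
      intro x hx hx'
      rw [mem_fixedIdeal] at hx hx'
      rw [mul_neg, hx] at hx'
      have h2 : (2 : ℂ) • x = 0 := by
        rw [two_smul]
        nth_rewrite 1 [← hx']
        exact neg_add_cancel x
      exact (smul_eq_zero.1 h2).resolve_left two_ne_zero
    · rw [codisjoint_iff, Submodule.eq_top_iff']
      intro x
      rw [Submodule.mem_sup]
      refine ⟨(2⁻¹ : ℂ) • (x + x * u), ?_, (2⁻¹ : ℂ) • (x - x * u), ?_, ?_⟩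
      · rw [mem_fixedIdeal, smul_mul_assoc, add_mul, mul_assoc, huu, mul_one, add_comm]
      · rw [mem_fixedIdeal, smul_mul_assoc, mul_neg, sub_mul, mul_assoc, huu, mul_one, neg_sub]
      · module

/-! ### Elements of the normalizer -/

theorem weyl_x_comm (i j : Fin n) : (Weyl.x i * Weyl.x j : Weyl n) = Weyl.x j * Weyl.x i := by
  have h := RingQuot.mkAlgHom_rel ℂ (WeylRel.x_comm (n := n) i j)
  rwa [map_mul, map_mul] at h

theorem weyl_d_comm (i j : Fin n) : (Weyl.d i * Weyl.d j : Weyl n) = Weyl.d j * Weyl.d i := by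
  have h := RingQuot.mkAlgHom_rel ℂ (WeylRel.d_comm (n := n) i j)
  rwa [map_mul, map_mul] at h

theorem weyl_d_x (i j : Fin n) :
    (Weyl.d i * Weyl.x j : Weyl n) = Weyl.x j * Weyl.d i + if i = j then 1 else 0 := by
  have h := RingQuot.mkAlgHom_rel ℂ (WeylRel.d_x (n := n) i j)
  rw [map_mul, map_add, map_mul] at h
  refine h.trans ?_
  congr 1
  split_ifs
  · exact map_one _
  · exact map_zero _

variable (η)

/-- The coordinate `x^i` in the Weyl–Clifford algebra. -/
def xx (i : Fin n) : WeylCl η := Weyl.x i ⊗ₜ 1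

/-- The partial derivative `∂_i` in the Weyl–Clifford algebra. -/
def dd (i : Fin n) : WeylCl η := Weyl.d i ⊗ₜ 1

/-- The generator `γ^i` in the Weyl–Clifford algebra. -/
def gg (i : Fin n) : WeylCl η := 1 ⊗ₜ gen η i

/-- The generator `γ_i = ∑ j, η_{ij} γ^j` with lowered index, where `η_{ij}` is the inverse
matrix of `η^{ij}`. -/
def gLow (i : Fin n) : WeylCl η := ∑ j, η⁻¹ i j • gg η j

/-- The derivative `∂^i = ∑ j, η^{ij} ∂_j` with raised index. -/
def dUp (i : Fin n) : WeylCl η := ∑ j, η i j • dd η j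

/-- The Euler operator `∑ i, x^i ∂_i`. -/
def euler : WeylCl η := ∑ i, xx η i * dd η i

/-- The vector variable `∑ i, γ_i x^i`. -/
def vecVar : WeylCl η := ∑ i, gLow η i * xx η i

variable {η}

theorem dirac_eq : dirac η = ∑ i, gg η i * dd η i := by
  simp [dirac, gg, dd]

theorem xx_comm (i j : Fin n) : xx η i * xx η j = xx η j * xx η i := by
  simp [xx, weyl_x_comm i j]

theorem dd_comm (i j : Fin n) : dd η i * dd η j = dd η j * dd η i := by
  simp [dd, weyl_d_comm i j]

theorem dd_xx (i j : Fin n) : dd η i * xx η j = xx η j * dd η i + if i = j then 1 else 0 := by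
  simp only [dd, xx, Algebra.TensorProduct.tmul_mul_tmul, weyl_d_x i j, TensorProduct.add_tmul,
    mul_one]
  split_ifs <;> simp [Algebra.TensorProduct.one_def]

theorem gg_xx (i j : Fin n) : gg η i * xx η j = xx η j * gg η i := by
  simp [gg, xx]

theorem gg_dd (i j : Fin n) : gg η i * dd η j = dd η j * gg η i := by
  simp [gg, dd]

theorem gg_gg (hsymm : η.IsSymm) (i j : Fin n) :
    gg η i * gg η j = (2 * η i j) • 1 - gg η j * gg η i := by
  rw [eq_sub_iff_add_eq]
  simp only [gg, Algebra.TensorProduct.tmul_mul_tmul, mul_one, ← TensorProduct.tmul_add]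
  rw [gen_mul_gen_add_swap hsymm, Algebra.algebraMap_eq_smul_one, TensorProduct.tmul_smul,
    Algebra.TensorProduct.one_def]

theorem euler_mul_xx (j : Fin n) : euler η * xx η j = xx η j * (euler η + 1) := by
  have h : ∀ i, xx η i * dd η i * xx η j =
      xx η j * (xx η i * dd η i) + if i = j then xx η j else 0 := by
    intro i
    rw [mul_assoc, dd_xx, mul_add, ← mul_assoc, xx_comm i j, mul_assoc]
    by_cases hij : i = j <;> simp [hij]
  rw [euler, Finset.sum_mul, Finset.sum_congr rfl fun i _ => h i, Finset.sum_add_distrib,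
    Finset.sum_ite_eq' Finset.univ j, if_pos (Finset.mem_univ j), mul_add, mul_one, Finset.mul_sum]

theorem dd_mul_euler (j : Fin n) : dd η j * euler η = (euler η + 1) * dd η j := by
  have h : ∀ i, dd η j * (xx η i * dd η i) =
      xx η i * dd η i * dd η j + if j = i then dd η i else 0 := by
    intro i
    rw [← mul_assoc, dd_xx, add_mul, mul_assoc, dd_comm j i, mul_assoc]
    by_cases hij : j = i <;> simp [hij]
  rw [euler, Finset.mul_sum, Finset.sum_congr rfl fun i _ => h i, Finset.sum_add_distrib,
    Finset.sum_ite_eq, if_pos (Finset.mem_univ j), add_mul, one_mul, Finset.sum_mul]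

theorem gg_mul_euler (j : Fin n) : gg η j * euler η = euler η * gg η j := by
  rw [euler, Finset.mul_sum, Finset.sum_mul]
  refine Finset.sum_congr rfl fun i _ => ?_
  rw [← mul_assoc, gg_xx, mul_assoc, gg_dd, mul_assoc]

theorem dirac_mul_dd (j : Fin n) : dirac η * dd η j = dd η j * dirac η := by
  rw [dirac_eq, Finset.mul_sum, Finset.sum_mul]
  refine Finset.sum_congr rfl fun i _ => ?_
  rw [mul_assoc, dd_comm, ← mul_assoc, gg_dd, mul_assoc]

theorem dirac_mul_dUp (j : Fin n) : dirac η * dUp η j = dUp η j * dirac η := by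
  rw [dUp, Finset.mul_sum, Finset.sum_mul]
  refine Finset.sum_congr rfl fun i _ => ?_
  rw [mul_smul_comm, smul_mul_assoc, dirac_mul_dd]

theorem dirac_mul_euler : dirac η * euler η = (euler η + 1) * dirac η := by
  rw [dirac_eq, Finset.mul_sum, Finset.sum_mul]
  refine Finset.sum_congr rfl fun i _ => ?_
  rw [mul_assoc, dd_mul_euler, ← mul_assoc, ← mul_assoc, mul_add, add_mul (euler η), gg_mul_euler,
    mul_one, one_mul]

theorem dUp_mul_euler (j : Fin n) : dUp η j * euler η = (euler η + 1) * dUp η j := by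
  rw [dUp, Finset.mul_sum, Finset.sum_mul]
  refine Finset.sum_congr rfl fun i _ => ?_
  rw [mul_smul_comm, smul_mul_assoc, dd_mul_euler]

theorem dirac_mul_xx (j : Fin n) : dirac η * xx η j = xx η j * dirac η + gg η j := by
  have h : ∀ i, gg η i * dd η i * xx η j =
      xx η j * (gg η i * dd η i) + if i = j then gg η j else 0 := by
    intro i
    rw [mul_assoc, dd_xx, mul_add, ← mul_assoc, gg_xx i j, mul_assoc]
    by_cases hij : i = j <;> simp [hij]
  rw [dirac_eq, Finset.sum_mul, Finset.sum_congr rfl fun i _ => h i, Finset.sum_add_distrib,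
    Finset.sum_ite_eq' Finset.univ j, if_pos (Finset.mem_univ j), Finset.mul_sum]

theorem dirac_mul_gg (hsymm : η.IsSymm) (j : Fin n) :
    dirac η * gg η j = (2 : ℂ) • dUp η j - gg η j * dirac η := by
  have h : ∀ i, gg η i * dd η i * gg η j =
      (2 : ℂ) • η j i • dd η i - gg η j * (gg η i * dd η i) := by
    intro i
    have hij : η j i = η i j := congrFun (congrFun hsymm i) j
    rw [mul_assoc, ← gg_dd, ← mul_assoc, gg_gg hsymm, sub_mul, smul_mul_assoc, one_mul, mul_assoc,
      smul_smul, hij]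
  rw [dirac_eq, Finset.sum_mul, Finset.sum_congr rfl fun i _ => h i, Finset.sum_sub_distrib,
    ← Finset.smul_sum, ← Finset.mul_sum, dUp]

theorem gLow_mul_gg_add_swap (hsymm : η.IsSymm) (hdet : IsUnit η.det) (i j : Fin n) :
    gg η i * gLow η j + gLow η j * gg η i = if i = j then (2 : ℂ) • 1 else 0 := by
  have h : ∀ k, gg η i * (η⁻¹ j k • gg η k) + (η⁻¹ j k • gg η k) * gg η i =
      (2 * (η⁻¹ j k * η k i)) • 1 := by
    intro k
    have hik : η k i = η i k := congrFun (congrFun hsymm i) k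
    rw [mul_smul_comm, smul_mul_assoc, ← smul_add, gg_gg hsymm i k, sub_add_cancel, smul_smul, hik]
    congr 1
    ring
  rw [gLow, Finset.mul_sum, Finset.sum_mul, ← Finset.sum_add_distrib,
    Finset.sum_congr rfl fun k _ => h k, ← Finset.sum_smul, ← Finset.mul_sum,
    ← Matrix.mul_apply, Matrix.nonsing_inv_mul _ hdet, Matrix.one_apply]
  by_cases hij : i = j
  · simp [hij]
  · simp [hij, Ne.symm hij]

theorem sum_gg_mul_gLow (hsymm : η.IsSymm) (hdet : IsUnit η.det) :
    ∑ i, gg η i * gLow η i = (n : ℂ) • 1 := by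
  have h1 : ∑ i, gg η i * gLow η i = ∑ i, gLow η i * gg η i := by
    have hinv : ∀ i j, η⁻¹ i j = η⁻¹ j i := fun i j => by
      have h := (Matrix.transpose_nonsing_inv η).trans (by rw [hsymm.eq])
      exact (congrFun (congrFun h j) i)
    simp only [gLow, Finset.mul_sum, Finset.sum_mul, mul_smul_comm, smul_mul_assoc]
    rw [Finset.sum_comm]
    exact Finset.sum_congr rfl fun i _ => Finset.sum_congr rfl fun j _ => by rw [hinv]
  have h2 : (2 : ℂ) • ∑ i, gg η i * gLow η i = (2 : ℂ) • ((n : ℂ) • (1 : WeylCl η)) := by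
    rw [two_smul]
    nth_rewrite 2 [h1]
    rw [← Finset.sum_add_distrib,
      Finset.sum_congr rfl fun i _ => gLow_mul_gg_add_swap hsymm hdet i i]
    simp [smul_smul, mul_comm, ← Nat.cast_smul_eq_nsmul ℂ]
  exact smul_right_injective _ (two_ne_zero (α := ℂ)) h2

theorem gLow_dd (i j : Fin n) : gLow η i * dd η j = dd η j * gLow η i := by
  simp only [gLow, Finset.mul_sum, Finset.sum_mul, mul_smul_comm, smul_mul_assoc, gg_dd]

theorem gLow_mul_euler (j : Fin n) : gLow η j * euler η = euler η * gLow η j := by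
  simp only [gLow, Finset.mul_sum, Finset.sum_mul, mul_smul_comm, smul_mul_assoc, gg_mul_euler]

theorem euler_mul_vecVar : euler η * vecVar η = vecVar η * (euler η + 1) := by
  rw [vecVar, Finset.mul_sum, Finset.sum_mul]
  refine Finset.sum_congr rfl fun i _ => ?_
  rw [← mul_assoc, ← gLow_mul_euler, mul_assoc, euler_mul_xx, mul_assoc]

/-- The basic relation of `osp(1|2)`: the Dirac operator and the vector variable anticommute to
`2 E + n`, where `E` is the Euler operator. -/
theorem dirac_mul_vecVar (hsymm : η.IsSymm) (hdet : IsUnit η.det) :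
    dirac η * vecVar η = (2 : ℂ) • euler η + (n : ℂ) • 1 - vecVar η * dirac η := by
  have h : ∀ i j, gg η i * dd η i * (gLow η j * xx η j) + gLow η j * xx η j * (gg η i * dd η i) =
      (if i = j then (2 : ℂ) • (xx η j * dd η i) else 0) +
        if i = j then gg η i * gLow η j else 0 := by
    intro i j
    have e1 : gg η i * dd η i * (gLow η j * xx η j) =
        gg η i * gLow η j * (xx η j * dd η i) + gg η i * gLow η j * (if i = j then 1 else 0) := by
      rw [← mul_add, ← dd_xx, mul_assoc, ← mul_assoc (dd η i), ← gLow_dd, mul_assoc, mul_assoc]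
    have e2 : gLow η j * xx η j * (gg η i * dd η i) =
        gLow η j * gg η i * (xx η j * dd η i) := by
      rw [mul_assoc, ← mul_assoc (xx η j), ← gg_xx, mul_assoc, mul_assoc]
    rw [e1, e2, add_right_comm, ← add_mul, gLow_mul_gg_add_swap hsymm hdet]
    by_cases hij : i = j <;> simp [hij]
  rw [eq_sub_iff_add_eq, dirac_eq, vecVar, Finset.sum_mul_sum, Finset.sum_mul_sum,
    Finset.sum_comm (γ := Fin n) (s := Finset.univ) (t := Finset.univ)
      (f := fun i j => gLow η i * xx η i * (gg η j * dd η j)), ← Finset.sum_add_distrib]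
  simp only [← Finset.sum_add_distrib, h]
  simp only [Finset.sum_add_distrib, Finset.sum_ite_eq, Finset.mem_univ, if_true,
    ← Finset.smul_sum, sum_gg_mul_gLow hsymm hdet]
  rfl

theorem sum_dUp_mul_dd (hsymm : η.IsSymm) : ∑ i, dUp η i * dd η i = dirac η * dirac η := by
  have h : dirac η * dirac η = (2 : ℂ) • ∑ i, dUp η i * dd η i - dirac η * dirac η := by
    conv_lhs => rw [dirac_eq, Finset.mul_sum, ← dirac_eq]
    have h1 : ∀ i, dirac η * (gg η i * dd η i) =
        (2 : ℂ) • (dUp η i * dd η i) - gg η i * dd η i * dirac η := by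
      intro i
      rw [← mul_assoc, dirac_mul_gg hsymm, sub_mul, smul_mul_assoc, mul_assoc, dirac_mul_dd,
        mul_assoc]
    rw [Finset.sum_congr rfl fun i _ => h1 i, Finset.sum_sub_distrib, ← Finset.smul_sum,
      ← Finset.sum_mul, ← dirac_eq]
  rw [eq_sub_iff_add_eq, ← two_smul ℂ] at h
  exact (smul_right_injective _ (two_ne_zero (α := ℂ)) h).symm

theorem dirac_mem_leftIdeal : dirac η ∈ leftIdeal η := by
  have h : (Complex.I / (Real.sqrt 2 : ℂ)) ≠ 0 := by simp
  have h2 := (leftIdeal η).mul_mem_left (algebraMap ℂ _ (Complex.I / (Real.sqrt 2 : ℂ))⁻¹)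
    (oddRoot_mem η)
  rwa [← Algebra.smul_def, oddRoot, smul_smul, inv_mul_cancel₀ h, one_smul] at h2

/-- The ideal `I` is generated by the Dirac operator `D`, so `a` normalizes `I` as soon as `D a` is
a left multiple of `D`. -/
theorem mem_normalizer_of_dirac_mul {a t : WeylCl η} (h : dirac η * a = t * dirac η) :
    a ∈ normalizer η := by
  have hD : dirac η * a ∈ leftIdeal η := h ▸ (leftIdeal η).mul_mem_left t dirac_mem_leftIdeal
  have hX : oddRoot η * a ∈ leftIdeal η := by
    rw [oddRoot, smul_mul_assoc, Algebra.smul_def]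
    exact (leftIdeal η).mul_mem_left _ hD
  intro b hb
  induction hb using Submodule.span_induction with
  | mem b hb =>
    rcases hb with rfl | rfl
    · exact hX
    · rw [pow_two, mul_assoc]
      exact (leftIdeal η).mul_mem_left _ hX
  | zero => simp
  | add b c _ _ hb hc => rw [add_mul]; exact add_mem hb hc
  | smul c b _ hb => rw [smul_eq_mul, mul_assoc]; exact (leftIdeal η).mul_mem_left _ hb

theorem dd_mem_normalizer (i : Fin n) : dd η i ∈ normalizer η :=
  mem_normalizer_of_dirac_mul (dirac_mul_dd i)

theorem euler_mem_normalizer : euler η ∈ normalizer η :=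
  mem_normalizer_of_dirac_mul dirac_mul_euler

variable (η) in
/-- The projection of left multiplication by `γ^i` to the solutions, with denominators cleared. -/
def gRed (i : Fin n) : WeylCl η :=
  gg η i * ((2 : ℂ) • euler η + ((n : ℂ) - 2) • 1) - (2 : ℂ) • (vecVar η * dUp η i)

variable (η) in
/-- The projection of multiplication by `x^i` to the solutions, with denominators cleared. -/
def xRed (i : Fin n) : WeylCl η :=
  xx η i * ((2 : ℂ) • euler η + (n : ℂ) • 1) - vecVar η * gg η i - vecVar η * vecVar η * dUp η i

theorem dirac_mul_gRed (hsymm : η.IsSymm) (hdet : IsUnit η.det) (i : Fin n) :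
    dirac η * gRed η i = ((2 : ℂ) • (vecVar η * dUp η i) -
      gg η i * ((2 : ℂ) • euler η + (n : ℂ) • 1)) * dirac η := by
  have e1 : dirac η * ((2 : ℂ) • euler η + ((n : ℂ) - 2) • 1) =
      ((2 : ℂ) • euler η + (n : ℂ) • 1) * dirac η := by
    rw [mul_add, mul_smul_comm, dirac_mul_euler, mul_smul_comm, mul_one, add_mul, add_mul,
      smul_mul_assoc, smul_mul_assoc, one_mul]
    module
  have e2 : dUp η i * ((2 : ℂ) • euler η + ((n : ℂ) - 2) • 1) =
      ((2 : ℂ) • euler η + (n : ℂ) • 1) * dUp η i := by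
    rw [mul_add, mul_smul_comm, dUp_mul_euler, mul_smul_comm, mul_one, add_mul, add_mul,
      smul_mul_assoc, smul_mul_assoc, one_mul]
    module
  rw [gRed, mul_sub, ← mul_assoc, dirac_mul_gg hsymm, sub_mul, smul_mul_assoc, e2, mul_assoc, e1,
    mul_smul_comm, ← mul_assoc (dirac η) (vecVar η), dirac_mul_vecVar hsymm hdet, sub_mul, sub_mul,
    mul_assoc (vecVar η), dirac_mul_dUp, smul_mul_assoc]
  simp only [← mul_assoc]
  module

theorem dirac_mul_xRed (hsymm : η.IsSymm) (hdet : IsUnit η.det) (i : Fin n) :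
    dirac η * xRed η i = (xx η i * ((2 : ℂ) • euler η + ((n : ℂ) + 2) • 1) -
      vecVar η * gg η i - vecVar η * vecVar η * dUp η i) * dirac η := by
  have e1 : dirac η * ((2 : ℂ) • euler η + (n : ℂ) • 1) =
      ((2 : ℂ) • euler η + ((n : ℂ) + 2) • 1) * dirac η := by
    rw [mul_add, mul_smul_comm, dirac_mul_euler, mul_smul_comm, mul_one, add_mul, add_mul,
      smul_mul_assoc, smul_mul_assoc, one_mul]
    module
  have e2 : dirac η * (vecVar η * vecVar η) =
      (2 : ℂ) • vecVar η + vecVar η * vecVar η * dirac η := by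
    rw [← mul_assoc, dirac_mul_vecVar hsymm hdet, sub_mul, add_mul, smul_mul_assoc,
      euler_mul_vecVar, mul_assoc (vecVar η), dirac_mul_vecVar hsymm hdet, mul_sub, mul_add,
      mul_add, mul_smul_comm, mul_smul_comm, smul_mul_assoc, mul_one, one_mul, ← mul_assoc]
    module
  have e3 : gg η i * ((2 : ℂ) • euler η + (n : ℂ) • 1) =
      ((2 : ℂ) • euler η + (n : ℂ) • 1) * gg η i := by
    rw [mul_add, add_mul, mul_smul_comm, smul_mul_assoc, gg_mul_euler, mul_smul_comm,
      smul_mul_assoc, mul_one, one_mul]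
  rw [xRed, mul_sub, mul_sub, ← mul_assoc, ← mul_assoc, ← mul_assoc (dirac η), dirac_mul_xx,
    add_mul (xx η i * dirac η), mul_assoc (xx η i), e1, e3, dirac_mul_vecVar hsymm hdet, sub_mul, mul_assoc (vecVar η),
    dirac_mul_gg hsymm, e2, add_mul ((2 : ℂ) • vecVar η), mul_assoc (vecVar η * vecVar η) (dirac η), dirac_mul_dUp,
    mul_sub, mul_smul_comm, smul_mul_assoc, sub_mul, sub_mul]
  simp only [← mul_assoc]
  module

theorem gRed_mem_normalizer (hsymm : η.IsSymm) (hdet : IsUnit η.det) (i : Fin n) :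
    gRed η i ∈ normalizer η :=
  mem_normalizer_of_dirac_mul (dirac_mul_gRed hsymm hdet i)

theorem xRed_mem_normalizer (hsymm : η.IsSymm) (hdet : IsUnit η.det) (i : Fin n) :
    xRed η i ∈ normalizer η :=
  mem_normalizer_of_dirac_mul (dirac_mul_xRed hsymm hdet i)

/-- Modulo the left ideal of the Dirac operator, lowering by `∂_i` and raising again by the
projected `x^i`, summed over `i`, is the polynomial `E (2 E + n - 2)` in the Euler operator. -/
theorem sum_xRed_mul_dd (hsymm : η.IsSymm) :
    ∑ i, xRed η i * dd η i = euler η * ((2 : ℂ) • euler η + ((n : ℂ) - 2) • 1) -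
      (vecVar η + vecVar η * vecVar η * dirac η) * dirac η := by
  have h : ∀ i, xRed η i * dd η i = xx η i * dd η i * ((2 : ℂ) • euler η + ((n : ℂ) - 2) • 1) -
      vecVar η * (gg η i * dd η i) - vecVar η * vecVar η * (dUp η i * dd η i) := by
    intro i
    have e1 : ((2 : ℂ) • euler η + (n : ℂ) • 1) * dd η i =
        dd η i * ((2 : ℂ) • euler η + ((n : ℂ) - 2) • 1) := by
      rw [mul_add, mul_smul_comm, dd_mul_euler, mul_smul_comm, mul_one, add_mul, add_mul,
        smul_mul_assoc, smul_mul_assoc, one_mul]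
      module
    rw [xRed, sub_mul, sub_mul, mul_assoc, e1]
    simp only [mul_assoc]
  rw [Finset.sum_congr rfl fun i _ => h i, Finset.sum_sub_distrib, Finset.sum_sub_distrib,
    ← Finset.sum_mul, ← Finset.mul_sum, ← Finset.mul_sum, ← dirac_eq, sum_dUp_mul_dd hsymm, add_mul,
    sub_sub, mul_assoc _ (dirac η)]
  rfl

/-! ### Coefficients of Clifford-valued polynomials -/

variable (η) in
/-- The coefficient of `x^α` of a Clifford-valued polynomial, an element of the Clifford algebra. -/
def clCoeff (α : Fin n →₀ ℕ) : ClPoly η →ₗ[ℂ] Cl η :=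
  Finsupp.lapply α ∘ₗ
    (TensorProduct.equivFinsuppOfBasisRight (MvPolynomial.basisMonomials (Fin n) ℂ)).toLinearMap

theorem clCoeff_tmul (α : Fin n →₀ ℕ) (c : Cl η) (p : MvPolynomial (Fin n) ℂ) :
    clCoeff η α (c ⊗ₜ p) = p.coeff α • c := by
  simp only [clCoeff, LinearMap.comp_apply, LinearEquiv.coe_coe, Finsupp.lapply_apply]
  exact TensorProduct.equivFinsuppOfBasisRight_apply_tmul_apply _ _ _ _

theorem eq_sum_clCoeff (φ : ClPoly η) : ∃ s : Finset (Fin n →₀ ℕ),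
    (∀ α, α ∉ s → clCoeff η α φ = 0) ∧
      φ = ∑ α ∈ s, clCoeff η α φ ⊗ₜ MvPolynomial.monomial α (1 : ℂ) := by
  set B := TensorProduct.equivFinsuppOfBasisRight (M := Cl η)
    (MvPolynomial.basisMonomials (Fin n) ℂ) with hB
  refine ⟨(B φ).support, fun α hα => Finsupp.notMem_support_iff.1 hα, ?_⟩
  have h := TensorProduct.equivFinsuppOfBasisRight_symm_apply
    (MvPolynomial.basisMonomials (Fin n) ℂ) (B φ)
  rw [LinearEquiv.symm_apply_apply] at h
  conv_lhs => rw [h]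
  refine Finset.sum_congr rfl fun α _ => ?_
  rw [MvPolynomial.coe_basisMonomials]
  rfl

theorem exists_degree_bound (φ : ClPoly η) : ∃ k : ℕ, ∀ α, k < α.degree → clCoeff η α φ = 0 := by
  obtain ⟨s, hs, -⟩ := eq_sum_clCoeff φ
  refine ⟨s.sup Finsupp.degree, fun α hα => hs α fun h => ?_⟩
  exact hα.not_ge (Finset.le_sup (f := Finsupp.degree) h)

theorem clCoeff_action_dd (i : Fin n) (α : Fin n →₀ ℕ) (φ : ClPoly η) :
    clCoeff η α (action η (dd η i) φ) =
      ((α i : ℂ) + 1) • clCoeff η (α + Finsupp.single i 1) φ := by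
  induction φ using TensorProduct.induction_on with
  | zero => simp
  | tmul c p =>
    rw [dd, action_tmul, clCoeff_tmul, clCoeff_tmul, weylAction_d, MvPolynomial.coeff_pderiv,
      one_mul, smul_smul, mul_comm]
  | add φ ψ h₁ h₂ => simp only [map_add, h₁, h₂, smul_add]

theorem coeff_X_mul_pderiv (i : Fin n) (α : Fin n →₀ ℕ) (p : MvPolynomial (Fin n) ℂ) :
    MvPolynomial.coeff α (MvPolynomial.X i * MvPolynomial.pderiv i p) = α i * p.coeff α := by
  rw [MvPolynomial.coeff_X_mul']
  split_ifs with h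
  · have h1 : 1 ≤ α i := Nat.one_le_iff_ne_zero.2 (Finsupp.mem_support_iff.1 h)
    have h2 : α - Finsupp.single i 1 + Finsupp.single i 1 = α :=
      tsub_add_cancel_of_le (by simpa using h1)
    rw [MvPolynomial.coeff_pderiv, h2, mul_comm]
    congr 1
    rw [Finsupp.tsub_apply, Finsupp.single_eq_same, Nat.cast_sub h1]
    simp
  · rw [Finsupp.notMem_support_iff.1 h]
    simp

theorem clCoeff_action_euler (α : Fin n →₀ ℕ) (φ : ClPoly η) :
    clCoeff η α (action η (euler η) φ) = (α.degree : ℂ) • clCoeff η α φ := by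
  have h : ∀ i, clCoeff η α (action η (xx η i * dd η i) φ) = (α i : ℂ) • clCoeff η α φ := by
    intro i
    induction φ using TensorProduct.induction_on with
    | zero => simp
    | tmul c p =>
      rw [map_mul, Module.End.mul_apply, dd, xx, action_tmul, action_tmul, clCoeff_tmul,
        clCoeff_tmul, weylAction_d, weylAction_x, coeff_X_mul_pderiv, one_mul, one_mul, smul_smul]
    | add φ ψ h₁ h₂ => simp only [map_add, h₁, h₂, smul_add]
  rw [euler, map_sum, LinearMap.sum_apply, map_sum, Finset.sum_congr rfl fun i _ => h i,
    ← Finset.sum_smul, Finsupp.degree_eq_sum]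
  push_cast
  rfl

theorem clCoeff_const (c : Cl η) (α : Fin n →₀ ℕ) :
    clCoeff η α (const η c) = if α = 0 then c else 0 := by
  rw [const, clCoeff_tmul, MvPolynomial.coeff_one]
  by_cases h : α = 0
  · simp [h]
  · simp [h, Ne.symm h]

theorem eq_const_of_clCoeff {φ : ClPoly η} (h : ∀ α, α ≠ 0 → clCoeff η α φ = 0) :
    φ = const η (clCoeff η 0 φ) := by
  obtain ⟨s, hs, hsum⟩ := eq_sum_clCoeff φ
  conv_lhs => rw [hsum]
  rw [Finset.sum_eq_single 0 (fun α _ hα => by rw [h α hα, TensorProduct.zero_tmul])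
    (fun h0 => by rw [hs 0 h0, TensorProduct.zero_tmul])]
  rfl

/-- The operators of the Weyl–Clifford algebra preserve the polynomials with coefficients in a
left ideal. -/
theorem clCoeff_action_mem {J : Submodule ℂ (Cl η)} (hJ : ∀ a x, x ∈ J → a * x ∈ J)
    (a : WeylCl η) {φ : ClPoly η} (hφ : ∀ α, clCoeff η α φ ∈ J) (α : Fin n →₀ ℕ) :
    clCoeff η α (action η a φ) ∈ J := by
  obtain ⟨s, -, hsum⟩ := eq_sum_clCoeff φ
  rw [hsum, map_sum, map_sum]
  refine J.sum_mem fun β _ => ?_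
  induction a using TensorProduct.induction_on with
  | zero => simp
  | tmul w c =>
    rw [action_tmul, clCoeff_tmul]
    exact J.smul_mem _ (hJ _ _ (hφ β))
  | add a b ha hb =>
    rw [map_add, LinearMap.add_apply, map_add]
    exact J.add_mem ha hb

theorem clCoeff_rightAction (c : (Cl η)ᵐᵒᵖ) (φ : ClPoly η) (α : Fin n →₀ ℕ) :
    clCoeff η α (rightAction η c φ) = clCoeff η α φ * c.unop := by
  induction φ using TensorProduct.induction_on with
  | zero => simp
  | tmul b p =>
    obtain ⟨c, rfl⟩ := MulOpposite.op_surjective c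
    rw [rightAction_tmul, clCoeff_tmul, clCoeff_tmul, smul_mul_assoc, MulOpposite.unop_op]
  | add φ ψ h₁ h₂ => simp only [map_add, h₁, h₂, add_mul]

/-! ### Submodules of the space of solutions -/

theorem const_add (c d : Cl η) : const η (c + d) = const η c + const η d :=
  TensorProduct.add_tmul _ _ _

theorem const_smul (r : ℂ) (c : Cl η) : const η (r • c) = r • const η c :=
  (TensorProduct.smul_tmul' _ _ _).symm

theorem const_zero : const η 0 = 0 := TensorProduct.zero_tmul _ _

/-- A submodule of the space of solutions, as a linear subspace of the Clifford-valued
polynomials. -/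
def polySubspace (W : Submodule (ReductionBimod η) (Solutions η)) : Submodule ℂ (ClPoly η) where
  carrier := {ψ | ∃ φ ∈ W, incl η φ = ψ}
  zero_mem' := ⟨0, W.zero_mem, map_zero _⟩
  add_mem' := by
    rintro _ _ ⟨φ, hφ, rfl⟩ ⟨ψ, hψ, rfl⟩
    exact ⟨φ + ψ, W.add_mem hφ hψ, map_add _ _ _⟩
  smul_mem' := by
    rintro r _ ⟨φ, hφ, rfl⟩
    refine ⟨_, W.smul_mem (ReductionBimod.tmul (toReduction η (algebraMap ℂ _ r)) 1) hφ, ?_⟩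
    rw [tmul_smul, map_one, Module.End.one_apply]
    exact LinearMap.congr_fun (AlgHom.commutes (action η) r) (incl η φ)

variable {W : Submodule (ReductionBimod η) (Solutions η)}

theorem incl_mem_polySubspace {φ : Solutions η} : incl η φ ∈ polySubspace W ↔ φ ∈ W :=
  ⟨fun ⟨_, h, e⟩ => incl_injective η e ▸ h, fun h => ⟨φ, h, rfl⟩⟩

theorem polySubspace_le_solutions : polySubspace W ≤ solutions η := by
  rintro _ ⟨φ, -, rfl⟩
  exact φ.2

theorem action_mem_polySubspace {a : WeylCl η} (ha : a ∈ normalizer η) {φ : ClPoly η}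
    (hφ : φ ∈ polySubspace W) : action η a φ ∈ polySubspace W := by
  obtain ⟨φ, hφ, rfl⟩ := hφ
  refine ⟨_, W.smul_mem (ReductionBimod.tmul (toReduction η ⟨a, ha⟩) 1) hφ, ?_⟩
  rw [tmul_smul, map_one, Module.End.one_apply]

theorem rightAction_mem_polySubspace (c : (Cl η)ᵐᵒᵖ) {φ : ClPoly η}
    (hφ : φ ∈ polySubspace W) : rightAction η c φ ∈ polySubspace W := by
  obtain ⟨φ, hφ, rfl⟩ := hφ
  refine ⟨_, W.smul_mem (ReductionBimod.tmul (toReduction η 1) c) hφ, ?_⟩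
  rw [tmul_smul]
  exact LinearMap.congr_fun (map_one (action η)) _

theorem action_dUp_const (i : Fin n) (c : Cl η) : action η (dUp η i) (const η c) = 0 := by
  simp [dUp, dd, const, action_tmul, weylAction_d]

theorem action_euler_const (c : Cl η) : action η (euler η) (const η c) = 0 := by
  simp [euler, dd, xx, const, action_tmul, weylAction_d]

theorem action_gg_const (i : Fin n) (c : Cl η) :
    action η (gg η i) (const η c) = const η (gen η i * c) := by
  simp [gg, const, action_tmul]

theorem action_gRed_const (i : Fin n) (c : Cl η) :
    action η (gRed η i) (const η c) = ((n : ℂ) - 2) • const η (gen η i * c) := by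
  rw [gRed, map_sub, map_mul, map_smul, map_mul, map_add, map_smul, map_smul, map_one]
  simp only [LinearMap.sub_apply, LinearMap.smul_apply, Module.End.mul_apply, LinearMap.add_apply,
    Module.End.one_apply, action_dUp_const, action_euler_const, map_zero, smul_zero, zero_add,
    sub_zero, map_smul, action_gg_const]

/-- The constants of a submodule are stable under left multiplication. The reduced generators act
on them as `(n - 2) γ^i`, so dimension two is exceptional. -/
theorem const_mul_mem (hn : n ≠ 2) (hsymm : η.IsSymm) (hdet : IsUnit η.det) (a c : Cl η)
    (hc : const η c ∈ polySubspace W) : const η (a * c) ∈ polySubspace W := by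
  have hn' : (n : ℂ) - 2 ≠ 0 := sub_ne_zero.2 (by exact_mod_cast hn)
  induction a using CliffordAlgebra.induction generalizing c with
  | algebraMap r =>
    rw [← Algebra.smul_def, const_smul]
    exact Submodule.smul_mem _ _ hc
  | ι v =>
    have hv : CliffordAlgebra.ι (quadForm η) v = ∑ i, v i • gen η i := by
      conv_lhs => rw [pi_eq_sum_univ' v, map_sum]
      refine Finset.sum_congr rfl fun i _ => ?_
      rw [map_smul]
      rfl
    have hsum : const η (CliffordAlgebra.ι (quadForm η) v * c) =
        ∑ i, v i • const η (gen η i * c) := by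
      rw [hv, Finset.sum_mul, const, TensorProduct.sum_tmul]
      refine Finset.sum_congr rfl fun i _ => ?_
      rw [smul_mul_assoc, ← const_smul]
      rfl
    rw [hsum]
    refine Submodule.sum_mem _ fun i _ => Submodule.smul_mem _ _ ?_
    have h := action_mem_polySubspace (gRed_mem_normalizer hsymm hdet i) hc
    rw [action_gRed_const] at h
    simpa [smul_smul, hn'] using Submodule.smul_mem _ ((n : ℂ) - 2)⁻¹ h
  | mul a b ha hb =>
    rw [mul_assoc]
    exact ha _ (hb _ hc)
  | add a b ha hb =>
    rw [add_mul, const_add]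
    exact Submodule.add_mem _ (ha _ hc) (hb _ hc)

/-- The two-sided ideal of the constants of a submodule of the space of solutions. -/
def constIdeal (hn : n ≠ 2) (hsymm : η.IsSymm) (hdet : IsUnit η.det)
    (W : Submodule (ReductionBimod η) (Solutions η)) : Submodule (ClBimod η) (Cl η) :=
  regularSubmodule
    { carrier := {c | const η c ∈ polySubspace W}
      zero_mem' := by
        rw [Set.mem_ofPred_eq, const_zero]
        exact Submodule.zero_mem _
      add_mem' := fun ha hb => by
        rw [Set.mem_ofPred_eq, const_add]
        exact Submodule.add_mem _ ha hb
      smul_mem' := fun r a ha => by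
        rw [Set.mem_ofPred_eq, const_smul]
        exact Submodule.smul_mem _ _ ha }
    (fun a x b hx => by
      rw [mul_assoc]
      refine const_mul_mem hn hsymm hdet a _ ?_
      have h := rightAction_mem_polySubspace (MulOpposite.op b) (W := W) (φ := const η x) hx
      rwa [const, rightAction_tmul] at h)

theorem mem_constIdeal {hn : n ≠ 2} {hsymm : η.IsSymm} {hdet : IsUnit η.det} {c : Cl η} :
    c ∈ constIdeal hn hsymm hdet W ↔ const η c ∈ polySubspace W := Iff.rfl

/-- The operator `k - E`, with `E` the Euler operator, removes the part of degree `k`, so the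
coefficients of degree less than `k` of an element of a submodule are, up to nonzero factors, those
of an element of lower degree. -/
theorem clCoeff_mem_constIdeal (hn : n ≠ 2) (hsymm : η.IsSymm) (hdet : IsUnit η.det)
    {φ : ClPoly η} (hφ : φ ∈ polySubspace W) (α : Fin n →₀ ℕ) :
    clCoeff η α φ ∈ constIdeal hn hsymm hdet W := by
  obtain ⟨k, hk⟩ := exists_degree_bound φ
  rw [← mem_regularSubspace]
  induction k generalizing φ α with
  | zero =>
    have h := eq_const_of_clCoeff fun α hα => hk α (Nat.pos_of_ne_zero
      (by rwa [Ne, Finsupp.degree_eq_zero_iff]))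
    by_cases hα : α = 0
    · subst hα
      rw [mem_regularSubspace, mem_constIdeal, ← h]
      exact hφ
    · rw [hk α (Nat.pos_of_ne_zero (by rwa [Ne, Finsupp.degree_eq_zero_iff]))]
      exact Submodule.zero_mem _
  | succ k ih =>
    by_cases hα : α = 0
    · subst hα
      have h := ih (φ := ((k + 1 : ℕ) : ℂ) • φ - action η (euler η) φ)
        (Submodule.sub_mem _ (Submodule.smul_mem _ _ hφ)
          (action_mem_polySubspace euler_mem_normalizer hφ)) 0 (fun β hβ => by
            rw [map_sub, map_smul, clCoeff_action_euler]
            rcases Nat.lt_or_ge (k + 1) β.degree with h | h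
            · rw [hk β h]
              simp
            · rw [show β.degree = k + 1 by lia, sub_self])
      rw [map_sub, map_smul, clCoeff_action_euler, map_zero, Nat.cast_zero, zero_smul,
        sub_zero] at h
      have h2 := Submodule.smul_mem _ (((k + 1 : ℕ) : ℂ))⁻¹ h
      rwa [smul_smul, inv_mul_cancel₀ (Nat.cast_ne_zero.2 k.succ_ne_zero), one_smul] at h2
    · obtain ⟨i, hi⟩ := Finsupp.ne_iff.1 hα
      have hle : Finsupp.single i 1 ≤ α := by
        simpa using Nat.one_le_iff_ne_zero.2 hi
      obtain ⟨β, rfl⟩ := exists_add_of_le hle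
      rw [add_comm]
      have h := ih (action_mem_polySubspace (dd_mem_normalizer i) hφ) β (fun β hβ => by
        rw [clCoeff_action_dd, hk _ (by simpa using hβ), smul_zero])
      rw [clCoeff_action_dd] at h
      have h2 := Submodule.smul_mem _ (((β i : ℂ) + 1))⁻¹ h
      rwa [smul_smul, inv_mul_cancel₀ (Nat.cast_add_one_ne_zero _), one_smul] at h2

/-- A solution with coefficients in the ideal of constants of `W` belongs to `W`. By induction on
the degree the derivatives `∂_i φ` belong to `W`, hence so does `∑ x̃^i ∂_i φ = E (2 E + n - 2) φ`;
for `φ` of degree at most `k` it differs from `k (2 k + n - 2) φ` by a solution of degree less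
than `k`. -/
theorem mem_polySubspace_of_clCoeff_mem (hn : n ≠ 2) (hsymm : η.IsSymm) (hdet : IsUnit η.det)
    {φ : ClPoly η} (hφ : φ ∈ solutions η)
    (hJ : ∀ α, clCoeff η α φ ∈ constIdeal hn hsymm hdet W) : φ ∈ polySubspace W := by
  obtain ⟨k, hk⟩ := exists_degree_bound φ
  induction k generalizing φ with
  | zero =>
    rw [eq_const_of_clCoeff fun α hα => hk α (Nat.pos_of_ne_zero
      (by rwa [Ne, Finsupp.degree_eq_zero_iff]))]
    exact hJ 0
  | succ k ih =>
    set J := regularSubspace (constIdeal hn hsymm hdet W) with hJdef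
    have hJact : ∀ (a : WeylCl η) (α), clCoeff η α (action η a φ) ∈ J := fun a =>
      clCoeff_action_mem (fun a x hx => by
        simpa [hJdef, mem_regularSubspace] using
          mul_mem_of_regular (constIdeal hn hsymm hdet W) a x 1 hx) a hJ
    have hd : ∀ i, action η (dd η i) φ ∈ polySubspace W := fun i =>
      ih (action_mem η (dd_mem_normalizer i) hφ) (hJact _) (fun β hβ => by
        rw [clCoeff_action_dd, hk _ (by simpa using hβ), smul_zero])
    have hT : action η (∑ i, xRed η i * dd η i) φ ∈ polySubspace W := by
      rw [map_sum, LinearMap.sum_apply]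
      refine Submodule.sum_mem _ fun i _ => ?_
      rw [map_mul, Module.End.mul_apply]
      exact action_mem_polySubspace (xRed_mem_normalizer hsymm hdet i) (hd i)
    have hcoeff : ∀ α, clCoeff η α (action η (∑ i, xRed η i * dd η i) φ) =
        ((α.degree : ℂ) * (2 * α.degree + (n - 2))) • clCoeff η α φ := by
      intro α
      have h0 : action η (dirac η) φ = 0 := hφ
      rw [sum_xRed_mul_dd hsymm, map_sub, LinearMap.sub_apply, map_mul _ _ (dirac η),
        Module.End.mul_apply, h0, map_zero, sub_zero, map_mul, Module.End.mul_apply,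
        clCoeff_action_euler, map_add, map_smul, map_smul, map_one]
      simp only [LinearMap.add_apply, LinearMap.smul_apply, Module.End.one_apply, map_add, map_smul,
        clCoeff_action_euler]
      module
    set r : ℂ := ((k + 1 : ℕ) : ℂ) * (2 * (k + 1 : ℕ) + (n - 2)) with hr
    -- in dimension zero every polynomial is constant; this case is excluded to make `r` nonzero
    by_cases hn0 : n = 0
    · subst hn0
      rw [eq_const_of_clCoeff (φ := φ) fun α hα => (hα (Subsingleton.elim _ _)).elim]
      exact hJ 0
    have hr0 : r ≠ 0 := by
      rw [hr, show (2 * ((k + 1 : ℕ) : ℂ) + (n - 2)) = ((2 * k + n : ℕ) : ℂ) by push_cast; ring]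
      exact mul_ne_zero (Nat.cast_ne_zero.2 k.succ_ne_zero) (Nat.cast_ne_zero.2 (by lia))
    have hsol : action η (∑ i, xRed η i * dd η i) φ ∈ solutions η := polySubspace_le_solutions hT
    have hlow := ih (φ := r • φ - action η (∑ i, xRed η i * dd η i) φ)
      (Submodule.sub_mem _ (Submodule.smul_mem _ _ hφ) hsol)
      (fun α => by
        rw [map_sub, map_smul]
        exact J.sub_mem (J.smul_mem _ (hJ α)) (hJact _ α))
      (fun α hα => by
        rw [map_sub, map_smul, hcoeff]
        rcases Nat.lt_or_ge (k + 1) α.degree with h | h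
        · rw [hk α h]
          simp
        · rw [show α.degree = k + 1 by lia, sub_self])
    have h := Submodule.smul_mem _ r⁻¹ (Submodule.add_mem _ hlow hT)
    rwa [sub_add_cancel, smul_smul, inv_mul_cancel₀ hr0, one_smul] at h

@[elab_as_elim]
theorem ReductionBimod.induction {P : ReductionBimod η → Prop} (zero : P 0)
    (tmul : ∀ a c, P (ReductionBimod.tmul (toReduction η a) c))
    (add : ∀ y z, P y → P z → P (y + z)) (z : ReductionBimod η) : P z := by
  refine TensorProduct.induction_on (motive := P) z zero (fun x c => ?_) add
  obtain ⟨a, rfl⟩ := Ideal.Quotient.mk_surjective x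
  exact tmul a c

/-- The submodule of the solutions with coefficients in a given two-sided ideal. -/
def solutionsIn (J : Submodule (ClBimod η) (Cl η)) :
    Submodule (ReductionBimod η) (Solutions η) where
  carrier := {φ | ∀ α, clCoeff η α (incl η φ) ∈ J}
  zero_mem' α := by simp
  add_mem' ha hb α := by
    rw [map_add, map_add]
    exact J.add_mem (ha α) (hb α)
  smul_mem' z φ hφ := by
    induction z using ReductionBimod.induction with
    | zero =>
      rw [zero_smul]
      intro α
      simp
    | tmul a c =>
      intro α
      rw [tmul_smul]
      refine clCoeff_action_mem (J := regularSubspace J) (fun a x hx => by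
        simpa [mem_regularSubspace] using mul_mem_of_regular J a x 1 hx) _ (fun β => ?_) α
      rw [clCoeff_rightAction]
      simpa [mem_regularSubspace] using mul_mem_of_regular J 1 _ c.unop (hφ β)
    | add y z hy hz =>
      intro α
      rw [add_smul, map_add, map_add]
      exact J.add_mem (hy α) (hz α)

/-- Submodules of the space of solutions correspond to two-sided ideals of the Clifford algebra. -/
def submoduleOrderIso (hn : n ≠ 2) (hsymm : η.IsSymm) (hdet : IsUnit η.det) :
    Submodule (ReductionBimod η) (Solutions η) ≃o Submodule (ClBimod η) (Cl η) where
  toFun := constIdeal hn hsymm hdet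
  invFun := solutionsIn
  left_inv W := by
    ext φ
    rw [← incl_mem_polySubspace (W := W)]
    exact ⟨fun h => mem_polySubspace_of_clCoeff_mem hn hsymm hdet φ.2 h,
      fun h α => clCoeff_mem_constIdeal hn hsymm hdet h α⟩
  right_inv J := by
    ext c
    rw [mem_constIdeal]
    refine (incl_mem_polySubspace (φ := constSol η c)).trans ⟨fun h => ?_, fun h α => ?_⟩
    · have h0 : clCoeff η 0 (const η c) ∈ J := h 0
      rwa [clCoeff_const, if_pos rfl] at h0
    · change clCoeff η α (const η c) ∈ J
      rw [clCoeff_const]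
      split_ifs
      · exact h
      · exact J.zero_mem
  map_rel_iff' {W W'} := by
    refine ⟨fun h φ hφ => ?_, fun h c hc => ?_⟩
    · rw [← incl_mem_polySubspace] at hφ ⊢
      exact mem_polySubspace_of_clCoeff_mem hn hsymm hdet φ.2
        fun α => h (clCoeff_mem_constIdeal hn hsymm hdet hφ α)
    · obtain ⟨φ, hφ, e⟩ := hc
      exact ⟨φ, h hφ, e⟩

theorem mem_submoduleOrderIso {hn : n ≠ 2} {hsymm : η.IsSymm} {hdet : IsUnit η.det} {c : Cl η} :
    c ∈ submoduleOrderIso hn hsymm hdet W ↔ constSol η c ∈ W :=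
  incl_mem_polySubspace (φ := constSol η c)

end DiracReduction

end

open DiracReduction in
theorem mainTheorem5 (n : ℕ) (hn : n ≠ 2) (η : Matrix (Fin n) (Fin n) ℂ)
    (hsymm : η.IsSymm) (hdet : IsUnit η.det) :
    -- `V⁺` is a representation, by the action on the left and by right multiplication
    (∀ (a : normalizer η) (c : Cl η) (φ : Solutions η),
      incl η (ReductionBimod.tmul (toReduction η a) (MulOpposite.op c) • φ) =
        rightAction η (MulOpposite.op c) (action η (a : WeylCl η) (incl η φ))) ∧
    -- its (irreducible) subrepresentations correspond to those of the regular representation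
    (∃ Φ : Submodule (ReductionBimod η) (Solutions η) ≃o Submodule (ClBimod η) (Cl η),
      (∀ (W : Submodule (ReductionBimod η) (Solutions η)) (c : Cl η),
        c ∈ Φ W ↔ constSol η c ∈ W) ∧
      (∀ W : Submodule (ReductionBimod η) (Solutions η),
        IsSimpleModule (ReductionBimod η) W ↔ IsSimpleModule (ClBimod η) (Φ W))) ∧
    (Even n → IsSimpleModule (ReductionBimod η) (Solutions η)) ∧
    (Odd n → ∃ W₁ W₂ : Submodule (ReductionBimod η) (Solutions η),
      IsSimpleModule (ReductionBimod η) W₁ ∧ IsSimpleModule (ReductionBimod η) W₂ ∧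
        IsCompl W₁ W₂) := by
  refine ⟨fun a c φ => ?_, ⟨submoduleOrderIso hn hsymm hdet, fun W c => mem_submoduleOrderIso,
    fun W => ?_⟩, fun h => ?_, fun h => ?_⟩
  · rw [tmul_smul, action_rightAction]
  · rw [isSimpleModule_iff_isAtom, isSimpleModule_iff_isAtom, OrderIso.isAtom_iff]
  · have := regular_isSimple_of_even hsymm hdet h
    rw [isSimpleModule_iff] at this ⊢
    exact (submoduleOrderIso hn hsymm hdet).isSimpleOrder_iff.2 this
  · obtain ⟨J₁, J₂, h₁, h₂, hc⟩ := exists_isAtom_isCompl_of_odd hsymm hdet h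
    let Ψ := (submoduleOrderIso hn hsymm hdet).symm
    refine ⟨Ψ J₁, Ψ J₂, ?_, ?_, (OrderIso.isCompl_iff Ψ).1 hc⟩
    · rw [isSimpleModule_iff_isAtom, OrderIso.isAtom_iff]
      exact h₁
    · rw [isSimpleModule_iff_isAtom, OrderIso.isAtom_iff]
      exact h₂
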